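/- **Proposition (Laplace–Carleson embeddings for normal semigroups).** Let $A$ be the generator of a strongly continuous semigroup $T=(T(t))_{t\ge 0}$ of normal operators on a complex Hilbert space $X$. Fix $s\in\rho(A)$, let $X_{-1}$ be the extrapolation space, i.e. the completion of $X$ in the norm $\|x\|_{X_{-1}}=\|(sI-A)^{-1}x\|_X$ (a Hilbert space), and let $A_{-1}$ and (again denoted) $T(t)$ be the continuous extensions of $A$ and $T(t)$ to $X_{-1}$, where $A_{-1}$ has domain $X$. Then $A_{-1}$ has a spectral measure $E_{-1}$, i.e. a projection-valued Borel measure on $\mathbb{C}$ with $A_{-1}=\int z\,\mathrm{d}E_{-1}(z)$. Let $1\le p\le\infty$, let $b\in X_{-1}\simeq\mathcal{L}(\mathbb{C},X_{-1})$, and define a measure $\mu$ on the Borel subsets $S$ of $\mathbb{C}$ by $$\mu(S)=\int_{-S}(1+|z|^2)\,\mathrm{d}\langle E_{-1}(z)b,b\rangle_{X_{-1}},\qquad -S=\{-z: z\in S\}.$$ Then $b$ is infinite-time $\mathrm{L}^p$-admissible for $T$, i.e. there is a constant $C$ such that for all $t\ge 0$ and all $u\in \mathrm{L}^p([0,t])$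 $$\int_0^t T(t-\tau)\,b\,u(\tau)\,\mathrm{d}\tau\in X\quad\text{and}\quad \Bigl\|\int_0^t T(t-\tau)\,b\,u(\tau)\,\mathrm{d}\tau\Bigr\|_X\le C\,\|u\|_{\mathrm{L}^p([0,t])},$$ if and only if the Laplace transform $(\mathscr{L}u)(z)=\int_0^\infty \mathrm{e}^{-zt}u(t)\,\mathrm{d}t$ is a bounded operator $$\mathscr{L}\colon \mathrm{L}^p([0,\infty))\to \mathrm{L}^2(\sigma(-A),\mu).$$ Here the latter means that there is a bounded linear operator between these spaces which maps every $u\in\mathrm{L}^p([0,\infty))$ whose Laplace integral converges absolutely at $\mu$-almost every point of $\sigma(-A)$ to that Laplace integral. -/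

import Mathlib

open MeasureTheory Set Filter Topology
open scoped ENNReal InnerProductSpace

noncomputable section

namespace LaplaceCarleson

/-! ### Unbounded operators: resolvent set, resolvent, spectrum -/

section Resolvent

variable {X : Type*} [NormedAddCommGroup X] [NormedSpace ℂ X]

/-- `R` is the bounded two-sided inverse of `s - A : D(A) → X`. -/
def IsResolventAt (A : X →ₗ.[ℂ] X) (s : ℂ) (R : X →L[ℂ] X) : Prop :=
  (∀ x : X, ∃ h : R x ∈ A.domain, s • R x - A ⟨R x, h⟩ = x) ∧
    ∀ x : A.domain, R (s • (x : X) - A x) = x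

/-- The resolvent set `ρ(A)`. -/
def opResolventSet (A : X →ₗ.[ℂ] X) : Set ℂ :=
  {s | ∃ R : X →L[ℂ] X, IsResolventAt A s R}

/-- The spectrum `σ(A)`. -/
def opSpectrum (A : X →ₗ.[ℂ] X) : Set ℂ :=
  (opResolventSet A)ᶜ

open Classical in
/-- The resolvent `R(s, A) = (s - A)⁻¹` for `s ∈ ρ(A)` (and `0` for other `s`). -/
def opResolvent (A : X →ₗ.[ℂ] X) (s : ℂ) : X →L[ℂ] X :=
  if h : ∃ R : X →L[ℂ] X, IsResolventAt A s R then h.choose else 0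

theorem isResolventAt_opResolvent {A : X →ₗ.[ℂ] X} {s : ℂ} (hs : s ∈ opResolventSet A) :
    IsResolventAt A s (opResolvent A s) := by
  have h : ∃ R : X →L[ℂ] X, IsResolventAt A s R := hs
  rw [opResolvent, dif_pos h]
  exact h.choose_spec

end Resolvent

/-! ### Strongly continuous semigroups and their generators -/

section Semigroup

variable {X : Type*} [NormedAddCommGroup X] [NormedSpace ℂ X]

/-- `(T(t))_{t ≥ 0}` is a strongly continuous semigroup of bounded operators on `X`
(the values of `T` at negative times play no role). -/
structure IsC0Semigroup (T : ℝ → X →L[ℂ] X) : Prop where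
  map_zero : T 0 = 1
  map_add : ∀ s t : ℝ, 0 ≤ s → 0 ≤ t → T (s + t) = T s * T t
  continuousOn : ∀ x : X, ContinuousOn (fun t => T t x) (Ici 0)

/-- `A` is the (infinitesimal) generator of `T`: `x ∈ D(A)` and `A x = y` if and only if
`(T(h) x - x) / h → y` as `h ↓ 0`. -/
def IsGenerator (A : X →ₗ.[ℂ] X) (T : ℝ → X →L[ℂ] X) : Prop :=
  ∀ x y : X, (x, y) ∈ A.graph ↔
    Tendsto (fun h : ℝ => h⁻¹ • (T h x - x)) (𝓝[>] 0) (𝓝 y)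

end Semigroup

/-! ### The extrapolation space `X₋₁`, and the extensions of the semigroup and of its generator -/

section Extrapolation

variable {X : Type*} [NormedAddCommGroup X] [InnerProductSpace ℂ X]

/-- The vector space `X`, to be given the weaker norm `x ↦ ‖(s - A)⁻¹ x‖`. -/
def PreExtrapolation (_A : X →ₗ.[ℂ] X) (_s : ℂ) : Type _ := X

variable (A : X →ₗ.[ℂ] X) (s : ℂ)

instance : AddCommGroup (PreExtrapolation A s) := inferInstanceAs (AddCommGroup X)

instance : Module ℂ (PreExtrapolation A s) := inferInstanceAs (Module ℂ X)

/-- The identity `X → PreExtrapolation A s`. -/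
def toPre : X ≃ₗ[ℂ] PreExtrapolation A s := LinearEquiv.refl ℂ X

/-- `(s - A)⁻¹`, on `X` with the weaker norm. -/
def preResolvent : PreExtrapolation A s →ₗ[ℂ] X :=
  (opResolvent A s).toLinearMap ∘ₗ (toPre A s).symm.toLinearMap

instance : SeminormedAddCommGroup (PreExtrapolation A s) :=
  SeminormedAddCommGroup.induced _ _ (preResolvent A s)

/-- The inner product is `⟨(s - A)⁻¹ x, (s - A)⁻¹ y⟩`. -/
instance : InnerProductSpace ℂ (PreExtrapolation A s) :=
  InnerProductSpace.induced (preResolvent A s)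

/-- The extrapolation space `X₋₁`: the completion of `X` for the norm `x ↦ ‖(s - A)⁻¹ x‖`. It is a
Hilbert space. -/
def Extrapolation : Type _ := UniformSpace.Completion (PreExtrapolation A s)

instance : NormedAddCommGroup (Extrapolation A s) :=
  inferInstanceAs (NormedAddCommGroup (UniformSpace.Completion (PreExtrapolation A s)))

instance : InnerProductSpace ℂ (Extrapolation A s) :=
  inferInstanceAs (InnerProductSpace ℂ (UniformSpace.Completion (PreExtrapolation A s)))

instance : CompleteSpace (Extrapolation A s) :=
  inferInstanceAs (CompleteSpace (UniformSpace.Completion (PreExtrapolation A s)))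

/-- The canonical map `X → X₋₁` (injective when `s ∈ ρ(A)`). -/
def embed : X →ₗ[ℂ] Extrapolation A s :=
  (UniformSpace.Completion.toComplₗᵢ (𝕜 := ℂ) (E := PreExtrapolation A s)).toLinearMap ∘ₗ
    (toPre A s).toLinearMap

/-- `A₋₁`, the extension of `A` to an operator in `X₋₁`, with domain `X` if `A` is densely defined and
`s ∈ ρ(A)`, that is continuous from `X` to `X₋₁`. It is obtained as the closure of `A` regarded
as an operator in `X₋₁`. -/
def extendedGenerator : Extrapolation A s →ₗ.[ℂ] Extrapolation A s :=
  (A.graph.map ((embed A s).prodMap (embed A s))).topologicalClosure.toLinearPMap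

/-- The extension of the operator `T(t)` to `X₋₁` by continuity, usually again
denoted `T(t)`. -/
def extendedSemigroup (T : ℝ → X →L[ℂ] X) (t : ℝ) : Extrapolation A s → Extrapolation A s :=
  UniformSpace.Completion.map fun x : PreExtrapolation A s =>
    toPre A s (T t ((toPre A s).symm x))

end Extrapolation

/-! ### Admissible control operators -/

section Admissible

variable {X : Type*} [NormedAddCommGroup X] [InnerProductSpace ℂ X]
variable {U : Type*} [NormedAddCommGroup U] [NormedSpace ℂ U]

/-- The control operator `B ∈ L(U, X₋₁)` is infinite-time `Lᵖ`-admissible for the semigroup `T` with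
generator `A`: there is a constant `C` such that, for all `t ≥ 0` and `u ∈ Lᵖ([0,t], U)`, the
integral `∫₀ᵗ T(t-τ) B u(τ) dτ` (in `X₋₁`) is an element `x` of `X` with `‖x‖ ≤ C ‖u‖`. -/
def InfiniteTimeAdmissible (p : ℝ≥0∞) (A : X →ₗ.[ℂ] X) (s : ℂ) (T : ℝ → X →L[ℂ] X)
    (B : U →L[ℂ] Extrapolation A s) : Prop :=
  ∃ C : ℝ, ∀ t : ℝ, 0 ≤ t → ∀ u : ℝ → U, MemLp u p (volume.restrict (Icc 0 t)) →
    ∃ x : X, embed A s x = ∫ τ in Icc 0 t, extendedSemigroup A s T (t - τ) (B (u τ)) ∧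
      ‖x‖ ≤ C * (eLpNorm u p (volume.restrict (Icc 0 t))).toReal

end Admissible

/-! ### Spectral measures -/

section SpectralMeasure

variable (H : Type*) [NormedAddCommGroup H] [InnerProductSpace ℂ H] [CompleteSpace H]

/-- A spectral measure (projection-valued measure) on the Borel sets of `ℂ`. -/
structure ProjectionMeasure where
  /-- The value of the measure on a set; only its values on Borel sets matter. -/
  proj : Set ℂ → H →L[ℂ] H
  isStarProjection : ∀ S, MeasurableSet S → IsStarProjection (proj S)
  empty : proj ∅ = 0
  univ : proj univ = 1
  inter : ∀ S S', MeasurableSet S → MeasurableSet S' → proj (S ∩ S') = proj S * proj S'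
  hasSum_iUnion : ∀ S : ℕ → Set ℂ, (∀ n, MeasurableSet (S n)) →
    Pairwise (Function.onFun Disjoint S) →
    ∀ x : H, HasSum (fun n => proj (S n) x) (proj (⋃ n, S n) x)

variable {H}

theorem ProjectionMeasure.inner_nonneg (E : ProjectionMeasure H) (x : H) {S : Set ℂ}
    (hS : MeasurableSet S) : 0 ≤ (⟪x, E.proj S x⟫_ℂ).re := by
  have h := E.isStarProjection S hS
  have h1 : E.proj S x = E.proj S (E.proj S x) := by
    conv_lhs => rw [← h.isIdempotentElem.eq]
    rfl
  have h2 : ContinuousLinearMap.adjoint (E.proj S) = E.proj S := h.isSelfAdjoint.star_eq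
  rw [h1, ← ContinuousLinearMap.adjoint_inner_left, h2]
  exact inner_self_nonneg (𝕜 := ℂ)

/-- The scalar measure `E_{x,x} : S ↦ ⟨E(S) x, x⟩`. -/
def ProjectionMeasure.diag (E : ProjectionMeasure H) (x : H) : Measure ℂ :=
  Measure.ofMeasurable (fun S _ => ENNReal.ofReal (⟪x, E.proj S x⟫_ℂ).re)
    (by simp [E.empty])
    (by
      intro S hS hd
      have h1 := (E.hasSum_iUnion S hS hd x).mapL (innerSL ℂ x)
      have h2 := Complex.hasSum_re h1
      simp only [innerSL_apply_apply] at h2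
      rw [← h2.tsum_eq]
      exact ENNReal.ofReal_tsum_of_nonneg (fun n => E.inner_nonneg x (hS n)) h2.summable)

/-- `E` is the spectral measure of the operator `A`, i.e. `A = ∫ z dE(z)`:
`D(A) = {x | ∫ |z|² dE_{x,x} < ∞}` and `⟨A x, x⟩ = ∫ z dE_{x,x}` for `x ∈ D(A)` (which determines
`A x`, by polarization). -/
def IsSpectralMeasureOf (E : ProjectionMeasure H) (A : H →ₗ.[ℂ] H) : Prop :=
  (∀ x : H, x ∈ A.domain ↔ ∫⁻ z, ‖z‖ₑ ^ 2 ∂(E.diag x) < ∞) ∧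
    ∀ x : A.domain, ⟪(x : H), A x⟫_ℂ = ∫ z, z ∂(E.diag (x : H))

variable (H) in
/-- The point mass at `0`. -/
def ProjectionMeasure.diracZero : ProjectionMeasure H where
  proj S := S.indicator (fun _ => 1) 0
  isStarProjection S _ := by
    by_cases h : (0 : ℂ) ∈ S
    · simp [h, IsStarProjection.one]
    · simp [h, IsStarProjection.zero]
  empty := by simp
  univ := by simp
  inter S S' _ _ := by
    by_cases h : (0 : ℂ) ∈ S <;> by_cases h' : (0 : ℂ) ∈ S' <;> simp [h, h']
  hasSum_iUnion S _ hd x := by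
    by_cases h : ∃ n, (0 : ℂ) ∈ S n
    · obtain ⟨n, hn⟩ := h
      have h1 : (0 : ℂ) ∈ ⋃ n, S n := mem_iUnion.2 ⟨n, hn⟩
      have h2 : ∀ m, m ≠ n → (S m).indicator (fun _ => (1 : H →L[ℂ] H)) 0 x = 0 := by
        intro m hm
        rw [indicator_of_notMem fun h0 => disjoint_left.1 (hd hm) h0 hn]
        rfl
      have h3 := hasSum_single n h2
      rw [indicator_of_mem hn] at h3
      rwa [indicator_of_mem h1]
    · push Not at h
      simp [h, hasSum_zero]

open Classical in
/-- The spectral measure of the operator `A`, which exists for normal `A` by the spectral theorem (for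
an operator that has no spectral measure, the value is the point mass at `0`). -/
def spectralMeasure (A : H →ₗ.[ℂ] H) : ProjectionMeasure H :=
  if h : ∃ E : ProjectionMeasure H, IsSpectralMeasureOf E A then h.choose
  else ProjectionMeasure.diracZero H

/-- The measure `μ(S) = ∫_{-S} (1 + |z|²) d⟨E(z) x, x⟩`: the weighted scalar spectral measure, moved by
the reflection `z ↦ -z` from the spectrum of `A` to that of `-A`. -/
def carlesonMeasure (E : ProjectionMeasure H) (x : H) : Measure ℂ :=
  ((E.diag x).withDensity fun z => 1 + ‖z‖ₑ ^ 2).map fun z => -z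

end SpectralMeasure

/-! ### The Laplace transform -/

section Laplace

/-- The Laplace transform `(𝓛 u)(z) = ∫₀^∞ e^{-zt} u(t) dt`. -/
def laplace (u : ℝ → ℂ) (z : ℂ) : ℂ :=
  ∫ t in Ici (0 : ℝ), Complex.exp (-z * t) * u t

/-- The Laplace transform is a bounded operator `Lᵖ([0,∞)) → L²(ν)`: there is a bounded operator `L`
such that `L u` is given by the Laplace integral of `u` whenever that integral converges absolutely at
`ν`-almost every point. (These `u` include all `u ∈ Lᵖ` of bounded support, and all `u ∈ Lᵖ` if `ν` is
concentrated on the open right half-plane. On the imaginary axis the integral of a general `u ∈ Lᵖ` need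
not converge, and there the operator is the extension by continuity, as for the Fourier transform on
`L²`.) -/
def LaplaceBounded (p : ℝ≥0∞) [Fact (1 ≤ p)] (ν : Measure ℂ) : Prop :=
  ∃ L : Lp ℂ p (volume.restrict (Ici (0 : ℝ))) →L[ℂ] Lp ℂ 2 ν,
    ∀ u : Lp ℂ p (volume.restrict (Ici (0 : ℝ))),
      (∀ᵐ z ∂ν, IntegrableOn (fun t : ℝ => Complex.exp (-z * t) * u t) (Ici 0)) →
        L u =ᵐ[ν] laplace u

end Laplace

end LaplaceCarleson

end

open LaplaceCarleson

open MeasureTheory Set Filter Topology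
open scoped ENNReal InnerProductSpace

noncomputable section

set_option linter.unusedSectionVars false

namespace LaplaceCarleson

/-! ### Spectral integrals for a representation of `C(K)` -/

section SpecInt

variable {K : Type*} [MetricSpace K] [CompactSpace K] [MeasurableSpace K] [BorelSpace K]
variable {H : Type*} [NormedAddCommGroup H] [InnerProductSpace ℂ H] [CompleteSpace H]
variable (φ : C(K, ℂ) →⋆ₐ[ℂ] (H →L[ℂ] H))

/-! Everything is computed on the spectrum `K` of the resolvent `R = (s - A)⁻¹`. By Fuglede's
theorem `R*` commutes with every `T(t)`, hence with `R`, so `R` is normal and the continuous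
functional calculus is a representation `φ` of `C(K)` with `R = φ(w)`, `w` the identity function.
Riesz representation attaches to each vector `x` a measure `μ_x` on `K`, and `g ↦ φ(g) x` extends to
an isometry `L²(μ_x) → X`. In this picture `A` is multiplication by `ζ = s - 1/w`, its spectral
measure is the image of that of `R` under `ζ`, and `T(t) x = ∫ e^{tζ} dE x`
(`semigroup_eq_specInt`).

The map `R` extends to a unitary `J : X₋₁ → X` that turns `A₋₁` into `A`, the extended semigroup
into `T`, and the inclusion `X → X₋₁` into `R`. With `c = J b`, admissibility asks that `∫₀ᵗ u(τ)
T(t-τ) c dτ` be `R x` with `‖x‖ ≤ C ‖u‖`. By Fubini this integral is `∫ h dE c`, where `h` is the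
Laplace transform of the time-reversed `u` at `-ζ` (`specInt_convolution`). It lies in the range of
`R` exactly when `h/w ∈ L²(μ_c)`, and then `‖x‖` is the norm of `h/w`. Since `1/|w|² = |s - ζ|²` is
comparable with `1 + |ζ|²`, this norm is comparable with the `L²(μ)` norm of a Laplace transform
over `[0,t]`. Admissibility is therefore a bound for these finite Laplace transforms that is uniform
in `t` (`admissible_iff_finLaplaceBounded`).

The uniform bound follows from boundedness of the Laplace transform by extending `u` by zero. For
the converse the operator is a weak limit, along an ultrafilter, of the transforms over `[0,n]`;
this includes `p = ∞`, where functions of bounded support are not dense. A weak limit agrees with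
the pointwise one wherever the latter exists (`ae_eq_of_weak_limit`).

The spectral measure of `A₋₁` in the statement is an arbitrary choice, so uniqueness of its scalar
measures is needed. Any spectral measure of `A` commutes with `R` and `R*`, hence with the
constructed one, and two commuting ones are compared on half-planes (`IsSpectralMeasureOf.diag_eq`).
-/

/-- A real continuous function as a complex one. -/
def complexify : C(K, ℝ) →ₗ[ℝ] C(K, ℂ) where
  toFun f := ⟨fun k => (f k : ℂ), by fun_prop⟩
  map_add' f g := by ext; simp
  map_smul' c f := by ext; simp

@[simp] theorem complexify_apply (f : C(K, ℝ)) (k : K) : complexify f k = f k := rfl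

theorem re_inner_star_mul (g : C(K, ℂ)) (x : H) :
    (⟪x, φ (star g * g) x⟫_ℂ).re = ‖φ g x‖ ^ 2 := by
  rw [map_mul, map_star, mul_apply_eq_comp, ContinuousLinearMap.star_eq_adjoint,
    ContinuousLinearMap.adjoint_inner_right]
  exact inner_self_eq_norm_sq (𝕜 := ℂ) _

/-- The positive functional `f ↦ ⟨φ(f) x, x⟩`. -/
def diagFunctional (x : H) : CompactlySupportedContinuousMap K ℝ →ₚ[ℝ] ℝ :=
  PositiveLinearMap.mk₀
    { toFun := fun f => (⟪x, φ (complexify f.toContinuousMap) x⟫_ℂ).re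
      map_add' := fun f g => by
        rw [show (f + g).toContinuousMap = f.toContinuousMap + g.toContinuousMap from rfl]
        simp
      map_smul' := fun c f => by
        rw [show (c • f).toContinuousMap = c • f.toContinuousMap from rfl, map_smul,
          show c • complexify f.toContinuousMap = (c : ℂ) • complexify f.toContinuousMap by
            ext; simp]
        rw [map_smul]
        simp }
    (by
      intro f hf
      have h : complexify f.toContinuousMap =
          star (complexify ⟨fun k => √(f k), by fun_prop⟩) *
            complexify ⟨fun k => √(f k), by fun_prop⟩ := by
        ext k
        have : (√(f k) : ℂ) * √(f k) = f k := by
          rw [← Complex.ofReal_mul, Real.mul_self_sqrt (hf k)]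
        simpa using! this.symm
      change 0 ≤ (⟪x, φ (complexify f.toContinuousMap) x⟫_ℂ).re
      rw [h, re_inner_star_mul]
      positivity)

/-- The measure on `K` representing `f ↦ ⟨φ(f) x, x⟩`. -/
def diagMeasure (x : H) : Measure K := RealRMK.rieszMeasure (diagFunctional φ x)

instance (x : H) : IsFiniteMeasure (diagMeasure φ x) := by
  unfold diagMeasure; infer_instance

theorem integral_norm_sq_diagMeasure (g : C(K, ℂ)) (x : H) :
    ∫ k, ‖g k‖ ^ 2 ∂(diagMeasure φ x) = ‖φ g x‖ ^ 2 := by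
  have h := RealRMK.integral_rieszMeasure (diagFunctional φ x)
    (CompactlySupportedContinuousMap.continuousMapEquiv ⟨fun k => ‖g k‖ ^ 2, by fun_prop⟩)
  refine h.trans ?_
  rw [← re_inner_star_mul]
  change (⟪x, φ (complexify ⟨fun k => ‖g k‖ ^ 2, by fun_prop⟩) x⟫_ℂ).re = _
  congr 4
  ext k
  exact (by simp [Complex.conj_mul'] : ((‖g k‖ ^ 2 : ℝ) : ℂ) = starRingEnd ℂ (g k) * g k)

/-- This isometry on the dense subspace `C(K)` is what makes the extension to all of `L²(μ_x)`
possible. -/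
theorem norm_toLp_diagMeasure (g : C(K, ℂ)) (x : H) :
    ‖ContinuousMap.toLp 2 (diagMeasure φ x) ℂ g‖ = ‖φ g x‖ := by
  have h1 : ‖ContinuousMap.toLp 2 (diagMeasure φ x) ℂ g‖ ^ 2 = ‖φ g x‖ ^ 2 := by
    rw [← integral_norm_sq_diagMeasure, ← inner_self_eq_norm_sq (𝕜 := ℂ), L2.inner_def,
      ← integral_re]
    · refine integral_congr_ae ?_
      filter_upwards [ContinuousMap.coeFn_toLp (diagMeasure φ x) (𝕜 := ℂ) (p := 2) g] with k hk
      rw [hk, inner_self_eq_norm_sq]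
    · exact L2.integrable_inner _ _
  exact (pow_left_inj₀ (norm_nonneg _) (norm_nonneg _) two_ne_zero).1 h1

/-- The isometry `L²(μ_x) → H`, `f ↦ ∫ f dE x`. -/
def specIntL (x : H) : Lp ℂ 2 (diagMeasure φ x) →L[ℂ] H :=
  LinearMap.extendOfNorm
    ((ContinuousLinearMap.apply ℂ H x).toLinearMap ∘ₗ (φ : C(K, ℂ) →ₐ[ℂ] (H →L[ℂ] H)).toLinearMap)
    (ContinuousMap.toLp 2 (diagMeasure φ x) ℂ : C(K, ℂ) →L[ℂ] _).toLinearMap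

theorem denseRange_toLp_diagMeasure (x : H) :
    DenseRange (ContinuousMap.toLp 2 (diagMeasure φ x) ℂ : C(K, ℂ) → Lp ℂ 2 (diagMeasure φ x)) :=
  ContinuousMap.toLp_denseRange _ _ _ (by simp)

theorem specIntL_toLp (x : H) (g : C(K, ℂ)) :
    specIntL φ x (ContinuousMap.toLp 2 (diagMeasure φ x) ℂ g) = φ g x :=
  LinearMap.extendOfNorm_eq (denseRange_toLp_diagMeasure φ x)
    ⟨1, fun g => by rw [one_mul]; exact (norm_toLp_diagMeasure φ g x).ge⟩ g

theorem norm_specIntL (x : H) (f : Lp ℂ 2 (diagMeasure φ x)) : ‖specIntL φ x f‖ = ‖f‖ := by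
  refine isClosed_property (denseRange_toLp_diagMeasure φ x)
    (isClosed_eq (specIntL φ x).continuous.norm continuous_norm) (fun g => ?_) f
  rw [specIntL_toLp, norm_toLp_diagMeasure]

theorem inner_specIntL (x : H) (f g : Lp ℂ 2 (diagMeasure φ x)) :
    ⟪specIntL φ x f, specIntL φ x g⟫_ℂ = ⟪f, g⟫_ℂ :=
  (⟨(specIntL φ x).toLinearMap, norm_specIntL φ x⟩ :
    Lp ℂ 2 (diagMeasure φ x) →ₗᵢ[ℂ] H).inner_map_map f g

open Classical in
/-- The spectral integral `∫ f dE x` for `f ∈ L²(μ_x)` (and `0` for other `f`). -/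
def specInt (x : H) (f : K → ℂ) : H :=
  if h : MemLp f 2 (diagMeasure φ x) then specIntL φ x (h.toLp f) else 0

variable {φ} {x : H} {f g : K → ℂ}

theorem specInt_eq (hf : MemLp f 2 (diagMeasure φ x)) :
    specInt φ x f = specIntL φ x (hf.toLp f) := dif_pos hf

theorem specInt_coeFn (f : Lp ℂ 2 (diagMeasure φ x)) : specInt φ x f = specIntL φ x f := by
  rw [specInt_eq (Lp.memLp f), Lp.toLp_coeFn]

theorem memLp_continuousMap (μ : Measure K) [IsFiniteMeasure μ] (g : C(K, ℂ)) : MemLp g 2 μ :=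
  (BoundedContinuousFunction.mkOfCompact g).memLp_top.mono_exponent le_top

theorem specInt_continuousMap (x : H) (g : C(K, ℂ)) : specInt φ x g = φ g x := by
  rw [specInt_eq (memLp_continuousMap _ g), ← specIntL_toLp]
  rfl

theorem specInt_congr_ae (h : f =ᵐ[diagMeasure φ x] g) : specInt φ x f = specInt φ x g := by
  by_cases hf : MemLp f 2 (diagMeasure φ x)
  · rw [specInt_eq hf, specInt_eq ((memLp_congr_ae h).1 hf), MemLp.toLp_congr hf _ h]
  · rw [specInt, dif_neg hf, specInt, dif_neg fun h' => hf ((memLp_congr_ae h).2 h')]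

theorem specInt_add (hf : MemLp f 2 (diagMeasure φ x)) (hg : MemLp g 2 (diagMeasure φ x)) :
    specInt φ x (f + g) = specInt φ x f + specInt φ x g := by
  rw [specInt_eq hf, specInt_eq hg, specInt_eq (hf.add hg), MemLp.toLp_add hf hg, map_add]

theorem specInt_sub (hf : MemLp f 2 (diagMeasure φ x)) (hg : MemLp g 2 (diagMeasure φ x)) :
    specInt φ x (f - g) = specInt φ x f - specInt φ x g := by
  rw [specInt_eq hf, specInt_eq hg, specInt_eq (hf.sub hg), MemLp.toLp_sub hf hg, map_sub]

theorem specInt_smul (c : ℂ) (hf : MemLp f 2 (diagMeasure φ x)) :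
    specInt φ x (c • f) = c • specInt φ x f := by
  rw [specInt_eq hf, specInt_eq (hf.const_smul c), MemLp.toLp_const_smul c hf, map_smul]

theorem enorm_specInt (hf : MemLp f 2 (diagMeasure φ x)) :
    ‖specInt φ x f‖ₑ = eLpNorm f 2 (diagMeasure φ x) := by
  rw [specInt_eq hf, ← ofReal_norm, norm_specIntL, Lp.norm_toLp, ENNReal.ofReal_toReal]
  exact hf.eLpNorm_ne_top

theorem eLpNorm_two_sq {α : Type*} [MeasurableSpace α] (f : α → ℂ) (μ : Measure α) :
    eLpNorm f 2 μ ^ 2 = ∫⁻ k, ‖f k‖ₑ ^ 2 ∂μ := by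
  have := eLpNorm_nnreal_pow_eq_lintegral (μ := μ) (f := f) (p := 2) two_ne_zero
  simpa using! this

theorem enorm_specInt_sq (hf : MemLp f 2 (diagMeasure φ x)) :
    ‖specInt φ x f‖ₑ ^ 2 = ∫⁻ k, ‖f k‖ₑ ^ 2 ∂(diagMeasure φ x) := by
  rw [enorm_specInt hf, eLpNorm_two_sq]

theorem inner_specInt (hf : MemLp f 2 (diagMeasure φ x)) (hg : MemLp g 2 (diagMeasure φ x)) :
    ⟪specInt φ x f, specInt φ x g⟫_ℂ = ∫ k, g k * starRingEnd ℂ (f k) ∂(diagMeasure φ x) := by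
  rw [specInt_eq hf, specInt_eq hg, inner_specIntL, L2.inner_def]
  refine integral_congr_ae ?_
  filter_upwards [hf.coeFn_toLp, hg.coeFn_toLp] with k h1 h2
  rw [h1, h2]
  rfl

theorem specInt_one (x : H) : specInt φ x (fun _ => 1) = x := by
  have := specInt_continuousMap (φ := φ) x 1
  rwa [map_one] at this

theorem diagMeasure_univ (x : H) : diagMeasure φ x univ = ‖x‖ₑ ^ 2 := by
  have h := enorm_specInt_sq (φ := φ) (x := x) (f := fun _ => 1) (memLp_const 1)
  rw [specInt_one] at h
  simp [h]

end SpecInt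

/-! ### The bounded Borel functional calculus -/

section BorelCalculus

variable {K : Type*} [MetricSpace K] [CompactSpace K] [MeasurableSpace K] [BorelSpace K]
variable {H : Type*} [NormedAddCommGroup H] [InnerProductSpace ℂ H] [CompleteSpace H]
variable {φ : C(K, ℂ) →⋆ₐ[ℂ] (H →L[ℂ] H)}

/-- A bounded measurable function. -/
def BddMeas {α : Type*} [MeasurableSpace α] (f : α → ℂ) : Prop :=
  Measurable f ∧ ∃ C : ℝ, ∀ k, ‖f k‖ ≤ C

theorem BddMeas.memLp {α : Type*} [MeasurableSpace α] {f : α → ℂ} (hf : BddMeas f)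
    (μ : Measure α) [IsFiniteMeasure μ] : MemLp f 2 μ :=
  MemLp.of_bound hf.1.aestronglyMeasurable hf.2.choose (ae_of_all _ hf.2.choose_spec)

theorem BddMeas.conj {α : Type*} [MeasurableSpace α] {f : α → ℂ} (hf : BddMeas f) :
    BddMeas (fun k => starRingEnd ℂ (f k)) :=
  ⟨(RCLike.continuous_conj.measurable (α := ℂ)).comp hf.1, hf.2.choose,
    fun k => by rw [RCLike.norm_conj]; exact hf.2.choose_spec k⟩

theorem BddMeas.indicator {α : Type*} [MeasurableSpace α] {S : Set α} (hS : MeasurableSet S) :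
    BddMeas (S.indicator fun _ => (1 : ℂ)) :=
  ⟨measurable_const.indicator hS, 1, fun k => by by_cases h : k ∈ S <;> simp [h]⟩

theorem bddMeas_continuousMap (g : C(K, ℂ)) : BddMeas g :=
  ⟨g.continuous.measurable, ‖g‖, g.norm_coe_le_norm⟩

theorem BddMeas.mul_memLp {α : Type*} [MeasurableSpace α] {f k : α → ℂ} {μ : Measure α}
    (hf : BddMeas f) (hk : MemLp k 2 μ) : MemLp (f * k) 2 μ := by
  obtain ⟨hf, C, hC⟩ := hf
  refine hk.of_le_mul (c := C) (hf.aestronglyMeasurable.mul hk.1) (ae_of_all _ fun a => ?_)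
  rw [Pi.mul_apply, norm_mul]
  exact mul_le_mul_of_nonneg_right (hC a) (norm_nonneg _)

/-- Used with `m` a sum of several `μ_x`: a single sequence of continuous functions then
approximates `f` in all these `L²` spaces at once, and identities for `φ` pass to the limit. -/
theorem exists_tendsto_continuousMap (m : Measure K) [IsFiniteMeasure m] {f : K → ℂ}
    (hf : MemLp f 2 m) :
    ∃ g : ℕ → C(K, ℂ), Tendsto (fun n => eLpNorm (f - ⇑(g n)) 2 m) atTop (𝓝 0) := by
  have h (n : ℕ) : ∃ g : C(K, ℂ), eLpNorm (f - ⇑g) 2 m ≤ (n + 1 : ℝ≥0∞)⁻¹ := by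
    obtain ⟨g, hg, -⟩ := hf.exists_boundedContinuous_eLpNorm_sub_le (by simp)
      (ε := (n + 1 : ℝ≥0∞)⁻¹) (by simp)
    exact ⟨g.toContinuousMap, hg⟩
  choose g hg using h
  refine ⟨g, tendsto_of_tendsto_of_tendsto_of_le_of_le tendsto_const_nhds ?_ (fun _ => zero_le) hg⟩
  have := (tendsto_add_atTop_iff_nat 1).2 ENNReal.tendsto_inv_nat_nhds_zero
  simpa using this

theorem tendsto_specInt_of_eLpNorm {ι : Type*} {l : Filter ι} {x : H} {f : K → ℂ} {g : ι → K → ℂ}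
    (hf : MemLp f 2 (diagMeasure φ x)) (hg : ∀ n, MemLp (g n) 2 (diagMeasure φ x))
    (h : Tendsto (fun n => eLpNorm (f - g n) 2 (diagMeasure φ x)) l (𝓝 0)) :
    Tendsto (fun n => specInt φ x (g n)) l (𝓝 (specInt φ x f)) := by
  rw [tendsto_iff_edist_tendsto_0]
  refine h.congr fun n => ?_
  rw [edist_comm, edist_eq_enorm_sub, ← specInt_sub hf (hg n), enorm_specInt (hf.sub (hg n))]

theorem tendsto_apply_specInt {m : Measure K} {x : H} (hm : diagMeasure φ x ≤ m) {f : K → ℂ}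
    (hf : MemLp f 2 (diagMeasure φ x)) {g : ℕ → C(K, ℂ)}
    (hg : Tendsto (fun n => eLpNorm (f - ⇑(g n)) 2 m) atTop (𝓝 0)) :
    Tendsto (fun n => φ (g n) x) atTop (𝓝 (specInt φ x f)) := by
  simp_rw [← specInt_continuousMap]
  refine tendsto_specInt_of_eLpNorm hf (fun n => memLp_continuousMap _ _) ?_
  exact tendsto_of_tendsto_of_tendsto_of_le_of_le tendsto_const_nhds hg (fun _ => zero_le)
    fun n => eLpNorm_mono_measure _ hm

variable {f g : K → ℂ}

/-- Not formal, because the space `L²(μ_x)` itself depends on `x`; the approximation is simultaneous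
for `x`, `y` and `x + y`. -/
theorem specInt_add_vec (hf : BddMeas f) (x y : H) :
    specInt φ (x + y) f = specInt φ x f + specInt φ y f := by
  obtain ⟨g, hg⟩ := exists_tendsto_continuousMap
    (diagMeasure φ x + diagMeasure φ y + diagMeasure φ (x + y)) (hf.memLp _)
  have h1 := tendsto_apply_specInt (Measure.le_add_right (Measure.le_add_right le_rfl))
    (hf.memLp (diagMeasure φ x)) hg
  have h2 := tendsto_apply_specInt (Measure.le_add_right (Measure.le_add_left le_rfl))
    (hf.memLp (diagMeasure φ y)) hg
  have h3 := tendsto_apply_specInt (Measure.le_add_left le_rfl)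
    (hf.memLp (diagMeasure φ (x + y))) hg
  exact tendsto_nhds_unique h3 ((h1.add h2).congr fun n => ((φ (g n)).map_add x y).symm)

/-- A bounded operator that commutes with `φ` commutes with the bounded Borel functional calculus. -/
theorem specInt_commute (hf : BddMeas f) (B : H →L[ℂ] H) (hB : ∀ g, Commute B (φ g)) (x : H) :
    B (specInt φ x f) = specInt φ (B x) f := by
  obtain ⟨g, hg⟩ := exists_tendsto_continuousMap
    (diagMeasure φ x + diagMeasure φ (B x)) (hf.memLp _)
  have h1 := tendsto_apply_specInt (Measure.le_add_right le_rfl) (hf.memLp (diagMeasure φ x)) hg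
  have h2 := tendsto_apply_specInt (Measure.le_add_left le_rfl) (hf.memLp (diagMeasure φ (B x))) hg
  exact tendsto_nhds_unique ((B.continuous.tendsto _).comp h1)
    (h2.congr fun n => (congr($((hB (g n)).eq) x)).symm)

theorem specInt_smul_vec (hf : BddMeas f) (c : ℂ) (x : H) :
    specInt φ (c • x) f = c • specInt φ x f :=
  (specInt_commute hf (c • 1) (fun _ => (Commute.one_left _).smul_left c) x).symm

theorem inner_specInt_left (hf : BddMeas f) (x y : H) :
    ⟪specInt φ x f, y⟫_ℂ = ⟪x, specInt φ y (fun k => starRingEnd ℂ (f k))⟫_ℂ := by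
  obtain ⟨g, hg⟩ := exists_tendsto_continuousMap
    (diagMeasure φ x + diagMeasure φ y) (hf.memLp _)
  have hg' : Tendsto (fun n => eLpNorm ((fun k => starRingEnd ℂ (f k)) - ⇑(star (g n) : C(K, ℂ))) 2
      (diagMeasure φ x + diagMeasure φ y)) atTop (𝓝 0) := by
    refine hg.congr fun n => eLpNorm_congr_norm_ae (ae_of_all _ fun k => ?_)
    exact (by rw [← RCLike.norm_conj, map_sub] :
      ‖f k - g n k‖ = ‖starRingEnd ℂ (f k) - starRingEnd ℂ (g n k)‖)
  have h1 := tendsto_apply_specInt (Measure.le_add_right le_rfl) (hf.memLp (diagMeasure φ x)) hg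
  have h2 := tendsto_apply_specInt (Measure.le_add_left le_rfl)
    (hf.conj.memLp (diagMeasure φ y)) hg'
  refine tendsto_nhds_unique (h1.inner tendsto_const_nhds)
    ((tendsto_const_nhds.inner h2).congr fun n => ?_)
  rw [map_star, ContinuousLinearMap.star_eq_adjoint, ContinuousLinearMap.adjoint_inner_right]

theorem norm_specInt_le (hf : Measurable f) {C : ℝ} (hC : ∀ k, ‖f k‖ ≤ C) (x : H) :
    ‖specInt φ x f‖ ≤ C * ‖x‖ := by
  -- If `K` is empty then `C` may be negative, but `‖x‖² = μ_x(K) = 0`.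
  rcases isEmpty_or_nonempty K with hK | ⟨⟨k⟩⟩
  · have h : x = 0 := by
      have := diagMeasure_univ (φ := φ) x
      rw [univ_eq_empty_iff.2 hK, measure_empty] at this
      simpa using this.symm
    rw [h, ← zero_smul ℂ (0 : H), specInt_smul_vec ⟨hf, C, hC⟩]
    simp
  · have hC0 : 0 ≤ C := (norm_nonneg _).trans (hC k)
    have h : ‖specInt φ x f‖ₑ ^ 2 ≤ (ENNReal.ofReal C * ‖x‖ₑ) ^ 2 := by
      rw [enorm_specInt_sq (BddMeas.memLp ⟨hf, C, hC⟩ _), mul_pow, ← diagMeasure_univ (φ := φ) x,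
        ← lintegral_const]
      refine lintegral_mono fun k => ?_
      gcongr
      rw [← ofReal_norm]
      exact ENNReal.ofReal_le_ofReal (hC k)
    have h' := (ENNReal.pow_le_pow_left_iff two_ne_zero).1 h
    rwa [← ofReal_norm, ← ofReal_norm, ← ENNReal.ofReal_mul hC0,
      ENNReal.ofReal_le_ofReal_iff (by positivity)] at h'

variable (φ) in
open Classical in
/-- The bounded Borel functional calculus. -/
def bddCalc (f : K → ℂ) : H →L[ℂ] H :=
  if hf : BddMeas f then
    LinearMap.mkContinuousOfExistsBound
      { toFun := fun x => specInt φ x f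
        map_add' := specInt_add_vec hf
        map_smul' := specInt_smul_vec hf } ⟨_, norm_specInt_le hf.1 hf.2.choose_spec⟩
  else 0

theorem bddCalc_apply (hf : BddMeas f) (x : H) : bddCalc φ f x = specInt φ x f := by
  rw [bddCalc, dif_pos hf]; rfl

/-- Multiplicativity of the spectral integral. -/
theorem specInt_specInt (hf : BddMeas f) {x : H} {k : K → ℂ} (hk : MemLp k 2 (diagMeasure φ x)) :
    specInt φ (specInt φ x k) f = specInt φ x (f * k) := by
  have hcomm (g g' : C(K, ℂ)) : Commute (φ g) (φ g') := by
    rw [commute_iff_eq, ← map_mul, ← map_mul, mul_comm]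
  -- The case of a continuous multiplier, by approximating `k`; the bounded Borel multiplier is
  -- reduced to it through commutation.
  have hc (g : C(K, ℂ)) {x : H} {k : K → ℂ} (hk : MemLp k 2 (diagMeasure φ x)) :
      φ g (specInt φ x k) = specInt φ x (g * k) := by
    obtain ⟨h, hh⟩ := exists_tendsto_continuousMap (diagMeasure φ x) hk
    have h1 := tendsto_apply_specInt le_rfl hk hh
    have h2 := ((φ g).continuous.tendsto _).comp h1
    refine tendsto_nhds_unique h2 ?_
    have h3 (n : ℕ) : φ g (φ (h n) x) = specInt φ x (g * h n) := by
      rw [← mul_apply_eq_comp, ← map_mul, ← specInt_continuousMap]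
      rfl
    refine Tendsto.congr (fun n => (h3 n).symm) (tendsto_specInt_of_eLpNorm
      ((bddMeas_continuousMap g).mul_memLp hk)
      (fun n => (bddMeas_continuousMap g).mul_memLp (memLp_continuousMap _ _)) ?_)
    have h4 := ENNReal.Tendsto.const_mul (a := ENNReal.ofReal ‖g‖) hh (Or.inr ENNReal.ofReal_ne_top)
    rw [mul_zero] at h4
    refine tendsto_of_tendsto_of_tendsto_of_le_of_le tendsto_const_nhds h4 (fun _ => zero_le)
      fun n => ?_
    refine eLpNorm_le_mul_eLpNorm_of_ae_le_mul (ae_of_all _ fun a => ?_) 2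
    rw [← mul_sub, Pi.mul_apply, norm_mul]
    exact mul_le_mul_of_nonneg_right (g.norm_coe_le_norm a) (norm_nonneg _)
  obtain ⟨h, hh⟩ := exists_tendsto_continuousMap
    (diagMeasure φ x + diagMeasure φ (specInt φ x k)) (hf.memLp _)
  obtain ⟨j, hj⟩ := exists_tendsto_continuousMap (diagMeasure φ x) hk
  have h1 := ((bddCalc φ f).continuous.tendsto _).comp (tendsto_apply_specInt le_rfl hk hj)
  rw [bddCalc_apply hf] at h1
  refine tendsto_nhds_unique h1 ?_
  -- Moving `φ (j n)` past the Borel function leaves a continuous multiplier acting on a spectral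
  -- integral.
  have h3 (n : ℕ) : bddCalc φ f (φ (j n) x) = specInt φ x (f * j n) := by
    rw [bddCalc_apply hf, ← specInt_commute hf _ (hcomm (j n)), hc _ (hf.memLp _), mul_comm]
  refine Tendsto.congr (fun n => (h3 n).symm) (tendsto_specInt_of_eLpNorm
    (hf.mul_memLp hk) (fun n => hf.mul_memLp (memLp_continuousMap _ _)) ?_)
  obtain ⟨-, C, hC⟩ := hf
  have h4 := ENNReal.Tendsto.const_mul (a := ENNReal.ofReal C) hj (Or.inr ENNReal.ofReal_ne_top)
  rw [mul_zero] at h4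
  refine tendsto_of_tendsto_of_tendsto_of_le_of_le tendsto_const_nhds h4 (fun _ => zero_le)
    fun n => ?_
  refine eLpNorm_le_mul_eLpNorm_of_ae_le_mul (ae_of_all _ fun a => ?_) 2
  rw [← mul_sub, Pi.mul_apply, norm_mul]
  exact mul_le_mul_of_nonneg_right (hC a) (norm_nonneg _)

end BorelCalculus

/-! ### Unbounded spectral integrals and the spectral measure of an operator with resolvent in `φ(C(K))` -/

section Unbounded

variable {K : Type*} [MetricSpace K] [CompactSpace K] [MeasurableSpace K] [BorelSpace K]
variable {H : Type*} [NormedAddCommGroup H] [InnerProductSpace ℂ H] [CompleteSpace H]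
variable {φ : C(K, ℂ) →⋆ₐ[ℂ] (H →L[ℂ] H)} {w : C(K, ℂ)}

theorem specInt_zero (x : H) : specInt φ x 0 = 0 := by
  have := specInt_continuousMap (φ := φ) x 0
  rwa [map_zero] at this

theorem apply_specInt (g : C(K, ℂ)) {x : H} {k : K → ℂ} (hk : MemLp k 2 (diagMeasure φ x)) :
    φ g (specInt φ x k) = specInt φ x (g * k) := by
  rw [← specInt_specInt (bddMeas_continuousMap g) hk, specInt_continuousMap]

theorem memLp_two_iff_lintegral_lt_top {α : Type*} [MeasurableSpace α] {μ : Measure α} {f : α → ℂ}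
    (hf : AEStronglyMeasurable f μ) : MemLp f 2 μ ↔ ∫⁻ a, ‖f a‖ₑ ^ 2 ∂μ < ∞ := by
  rw [← eLpNorm_two_sq]
  constructor
  · exact fun h => ENNReal.pow_lt_top h.2
  · exact fun h => ⟨hf, by simpa using h⟩

/-- The vector `∫ 1_{w = 0} dE x` is killed by `φ w`, hence zero, and its squared norm is `μ_x {w =
0}`. -/
theorem ae_ne_zero_of_injective (hw : Function.Injective (φ w)) (x : H) :
    ∀ᵐ k ∂(diagMeasure φ x), w k ≠ 0 := by
  have hS : MeasurableSet {k | w k = 0} := (isClosed_eq w.continuous continuous_const).measurableSet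
  have hb := BddMeas.indicator hS
  have h1 : φ w (specInt φ x ({k | w k = 0}.indicator fun _ => 1)) = φ w 0 := by
    rw [apply_specInt w (hb.memLp _), map_zero, ← specInt_zero (φ := φ) x]
    congr 1
    ext k
    by_cases h : w k = 0 <;> simp [h]
  have h3 := enorm_specInt_sq (hb.memLp (diagMeasure φ x))
  rw [hw h1] at h3
  have h4 (a : K) : ‖{k | w k = 0}.indicator (fun _ => (1 : ℂ)) a‖ₑ ^ 2 =
      {k | w k = 0}.indicator 1 a := by
    by_cases h : w a = 0 <;> simp [h]
  simp_rw [h4] at h3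
  rw [lintegral_indicator_one hS] at h3
  rw [ae_iff]
  simpa using h3.symm

theorem apply_specInt_div (hw : Function.Injective (φ w)) {x : H} {h : K → ℂ}
    (hh : MemLp (h / ⇑w) 2 (diagMeasure φ x)) : φ w (specInt φ x (h / ⇑w)) = specInt φ x h := by
  rw [apply_specInt w hh]
  refine specInt_congr_ae ?_
  filter_upwards [ae_ne_zero_of_injective hw x] with k hk
  rw [Pi.mul_apply, Pi.div_apply, mul_div_cancel₀ _ hk]

/-- The set where `1 / w` is bounded by `n + 1`. -/
def truncSet (w : C(K, ℂ)) (n : ℕ) : Set K := {k | (1 : ℝ) ≤ (n + 1 : ℝ) * ‖w k‖}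

theorem measurableSet_truncSet (n : ℕ) : MeasurableSet (truncSet w n) :=
  (isClosed_le continuous_const (by fun_prop)).measurableSet

theorem ne_zero_of_mem_truncSet {n : ℕ} {k : K} (hk : k ∈ truncSet w n) : w k ≠ 0 := by
  intro h0
  simp only [truncSet, mem_ofPred_eq, h0, norm_zero, mul_zero] at hk
  linarith

theorem norm_inv_le_of_mem_truncSet {n : ℕ} {k : K} (hk : k ∈ truncSet w n) :
    ‖(w k)⁻¹‖ ≤ n + 1 := by
  rw [norm_inv, inv_le_iff_one_le_mul₀ (norm_pos_iff.2 (ne_zero_of_mem_truncSet hk))]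
  exact hk

theorem monotone_truncSet : Monotone (truncSet w) := by
  intro m n hmn k hk
  refine le_trans (show (1 : ℝ) ≤ (m + 1 : ℝ) * ‖w k‖ from hk) ?_
  gcongr

theorem ae_mem_iUnion_truncSet (hw : Function.Injective (φ w)) (x : H) :
    ∀ᵐ k ∂(diagMeasure φ x), k ∈ ⋃ n, truncSet w n := by
  filter_upwards [ae_ne_zero_of_injective hw x] with k hk
  obtain ⟨n, hn⟩ := exists_nat_gt (‖w k‖⁻¹)
  refine mem_iUnion.2 ⟨n, ?_⟩
  have h1 : 0 < ‖w k‖ := norm_pos_iff.2 hk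
  change (1 : ℝ) ≤ (n + 1 : ℝ) * ‖w k‖
  rw [← inv_le_iff_one_le_mul₀ h1]
  linarith

theorem lintegral_eq_iSup_truncSet (hw : Function.Injective (φ w)) (x : H) (f : K → ℝ≥0∞) :
    ∫⁻ k, f k ∂(diagMeasure φ x) = ⨆ n, ∫⁻ k in truncSet w n, f k ∂(diagMeasure φ x) := by
  rw [← setLIntegral_iUnion_of_directed _ monotone_truncSet.directed_le,
    Measure.restrict_eq_self_of_ae_mem (ae_mem_iUnion_truncSet hw x)]

theorem eq_zero_of_specInt_truncSet (hw : Function.Injective (φ w)) {x : H}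
    (h : ∀ n, specInt φ x ((truncSet w n).indicator fun _ => 1) = 0) : x = 0 := by
  have h1 := lintegral_eq_iSup_truncSet hw x fun _ => 1
  rw [lintegral_one, diagMeasure_univ] at h1
  have h2 (n : ℕ) : ∫⁻ k in truncSet w n, (1 : ℝ≥0∞) ∂(diagMeasure φ x) = 0 := by
    have h3 := enorm_specInt_sq
      ((BddMeas.indicator (measurableSet_truncSet (w := w) n)).memLp (diagMeasure φ x))
    rw [h n, enorm_zero, zero_pow two_ne_zero] at h3
    rw [h3, ← lintegral_indicator (measurableSet_truncSet n)]
    refine lintegral_congr fun a => ?_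
    by_cases h : a ∈ truncSet w n <;> simp [h]
  simp_rw [h2] at h1
  simpa using h1

/-- Describes the range of `φ w`: truncations of `h / w` are truncations of `y`, so their norms are
at most `‖y‖`, and monotone convergence removes the truncation. -/
theorem memLp_div_of_apply_eq (hw : Function.Injective (φ w)) {x y : H} {h : K → ℂ}
    (hh : MemLp h 2 (diagMeasure φ x)) (hy : φ w y = specInt φ x h) :
    MemLp (h / ⇑w) 2 (diagMeasure φ x) ∧ y = specInt φ x (h / ⇑w) := by
  suffices H : MemLp (h / ⇑w) 2 (diagMeasure φ x) from
    ⟨H, hw (hy.trans (apply_specInt_div hw H).symm)⟩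
  have hf (n : ℕ) : BddMeas ((truncSet w n).indicator fun k => (w k)⁻¹) := by
    refine ⟨(w.continuous.measurable.inv).indicator (measurableSet_truncSet n), n + 1, fun k => ?_⟩
    by_cases hk : k ∈ truncSet w n
    · rw [indicator_of_mem hk]
      exact norm_inv_le_of_mem_truncSet hk
    · rw [indicator_of_notMem hk, norm_zero]
      positivity
  have hbound (n : ℕ) : ∫⁻ k in truncSet w n, ‖(h / ⇑w) k‖ₑ ^ 2 ∂(diagMeasure φ x) ≤ ‖y‖ₑ ^ 2 := by
    -- Applying the bounded function `1_{truncSet} / w` to both sides of `φ w y = ∫ h dE x` gives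
    -- the truncation of `y` on the left.
    have h1 := specInt_specInt (hf n) hh
    have h2 := specInt_specInt (hf n) (memLp_continuousMap (diagMeasure φ y) w)
    rw [specInt_continuousMap, hy, h1] at h2
    have h3 := enorm_specInt_sq ((hf n).mul_memLp hh)
    rw [h2, enorm_specInt_sq ((hf n).mul_memLp (memLp_continuousMap _ _))] at h3
    rw [← diagMeasure_univ (φ := φ) y, ← lintegral_indicator (measurableSet_truncSet n)]
    refine le_of_eq_of_le (Eq.trans ?_ h3.symm) ?_
    · refine lintegral_congr fun k => ?_
      by_cases hk : k ∈ truncSet w n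
      · simp [hk, div_eq_inv_mul]
      · simp [hk]
    · rw [← lintegral_one]
      refine lintegral_mono fun k => ?_
      by_cases hk : k ∈ truncSet w n
      · simp [hk, ne_zero_of_mem_truncSet hk]
      · simp [hk]
  rw [memLp_two_iff_lintegral_lt_top (hh.1.div₀ w.continuous.aestronglyMeasurable),
    lintegral_eq_iSup_truncSet hw]
  exact (iSup_le hbound).trans_lt (by simp)

variable (φ) in
/-- The projection-valued measure `S ↦ 1_{ζ⁻¹(S)}`. -/
def projMeasure (ζ : K → ℂ) (hζ : Measurable ζ) : ProjectionMeasure H where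
  proj S := bddCalc φ ((ζ ⁻¹' S).indicator fun _ => 1)
  isStarProjection S hS := by
    have hb := BddMeas.indicator (hζ hS)
    constructor
    · refine ContinuousLinearMap.ext fun x => ?_
      rw [mul_apply_eq_comp, bddCalc_apply hb, bddCalc_apply hb, specInt_specInt hb (hb.memLp _)]
      congr 1
      ext k
      by_cases h : k ∈ ζ ⁻¹' S <;> simp [h]
    · rw [isSelfAdjoint_iff, ContinuousLinearMap.star_eq_adjoint]
      refine (ContinuousLinearMap.eq_adjoint_iff _ _).2 (fun x y => ?_) |>.symm
      rw [bddCalc_apply hb, bddCalc_apply hb, inner_specInt_left hb]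
      congr 2
      ext k
      by_cases h : k ∈ ζ ⁻¹' S <;> simp [h]
  empty := by
    refine ContinuousLinearMap.ext fun x => ?_
    rw [bddCalc_apply (BddMeas.indicator (hζ .empty))]
    simpa using! specInt_zero x
  univ := by
    refine ContinuousLinearMap.ext fun x => ?_
    rw [bddCalc_apply (BddMeas.indicator (hζ .univ))]
    simpa using specInt_one x
  inter S S' hS hS' := by
    refine ContinuousLinearMap.ext fun x => ?_
    rw [mul_apply_eq_comp, bddCalc_apply (BddMeas.indicator (hζ (hS.inter hS'))),
      bddCalc_apply (BddMeas.indicator (hζ hS)), bddCalc_apply (BddMeas.indicator (hζ hS')),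
      specInt_specInt (BddMeas.indicator (hζ hS)) ((BddMeas.indicator (hζ hS')).memLp _)]
    congr 1
    ext k
    by_cases h : k ∈ ζ ⁻¹' S <;> by_cases h' : k ∈ ζ ⁻¹' S' <;> simp_all
  hasSum_iUnion S hS hd x := by
    have hb (S : Set ℂ) (hS : MeasurableSet S) := BddMeas.indicator (hζ hS)
    rw [bddCalc_apply (hb _ (.iUnion hS))]
    simp_rw [fun n => bddCalc_apply (φ := φ) (hb _ (hS n))]
    have hfin (t : Finset ℕ) : ∑ n ∈ t, specInt φ x ((ζ ⁻¹' S n).indicator fun _ => 1) =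
        specInt φ x ((ζ ⁻¹' ⋃ n ∈ t, S n).indicator fun _ => 1) := by
      induction t using Finset.induction_on with
      | empty => simpa using! (specInt_zero x).symm
      | insert a t ha ih =>
        have hmt : MeasurableSet (⋃ n ∈ t, S n) := .biUnion t.countable_toSet fun n _ => hS n
        rw [Finset.sum_insert ha, ih, ← specInt_add ((hb _ (hS a)).memLp _) ((hb _ hmt).memLp _)]
        congr 1
        rw [Finset.set_biUnion_insert, preimage_union, indicator_union_of_disjoint]
        · rfl
        · refine Disjoint.preimage ζ (disjoint_iUnion₂_right.2 fun n hn => hd ?_)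
          rintro rfl
          exact ha hn
    unfold HasSum
    simp only [SummationFilter.unconditional_filter]
    simp_rw [hfin]
    have hmt (t : Finset ℕ) : MeasurableSet (⋃ n ∈ t, S n) :=
      .biUnion t.countable_toSet fun n _ => hS n
    refine tendsto_specInt_of_eLpNorm ((hb _ (.iUnion hS)).memLp _)
      (fun t => (hb _ (hmt t)).memLp _) ?_
    -- The squared `L²(μ_x)` distance is the mass of the sets not yet summed, so strong σ-additivity
    -- reduces to σ-additivity of `μ_x`.
    have h1 (t : Finset ℕ) : eLpNorm (((ζ ⁻¹' ⋃ n, S n).indicator fun _ => (1 : ℂ)) -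
        (ζ ⁻¹' ⋃ n ∈ t, S n).indicator fun _ => (1 : ℂ)) 2 (diagMeasure φ x) =
        (diagMeasure φ x (⋃ n, ζ ⁻¹' S n) -
          ∑ n ∈ t, diagMeasure φ x (ζ ⁻¹' S n)) ^ (1 / 2 : ℝ) := by
      have hsub : (⋃ n ∈ t, ζ ⁻¹' S n) ⊆ ⋃ n, ζ ⁻¹' S n :=
        iUnion₂_subset fun n _ => subset_iUnion (fun n => ζ ⁻¹' S n) n
      have hmz (n : ℕ) := hζ (hS n)
      have hmu : MeasurableSet (⋃ n ∈ t, ζ ⁻¹' S n) := t.measurableSet_biUnion fun n _ => hmz n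
      rw [preimage_iUnion₂, preimage_iUnion, ← indicator_sdiff hsub,
        eLpNorm_indicator_const ((MeasurableSet.iUnion hmz).diff hmu) (by simp) (by simp),
        measure_sdiff hsub hmu.nullMeasurableSet (by simp),
        measure_biUnion_finset (fun i _ j _ hij => (hd hij).preimage ζ) (fun n _ => hmz n)]
      simp
    simp_rw [h1]
    have h2 : Tendsto (fun t : Finset ℕ => ∑ n ∈ t, diagMeasure φ x (ζ ⁻¹' S n)) atTop
        (𝓝 (diagMeasure φ x (⋃ n, ζ ⁻¹' S n))) := by
      rw [measure_iUnion (fun i j hij => (hd hij).preimage ζ) fun n => hζ (hS n)]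
      exact ENNReal.summable.hasSum
    have h3 := (ENNReal.Tendsto.sub tendsto_const_nhds h2 (Or.inl (by simp))).ennrpow_const (1 / 2)
      (a := diagMeasure φ x (⋃ n, ζ ⁻¹' S n) - diagMeasure φ x (⋃ n, ζ ⁻¹' S n))
    rwa [tsub_self, ENNReal.zero_rpow_of_pos (by norm_num)] at h3

theorem projMeasure_apply {ζ : K → ℂ} (hζ : Measurable ζ) {S : Set ℂ} (hS : MeasurableSet S)
    (x : H) : (projMeasure φ ζ hζ).proj S x = specInt φ x ((ζ ⁻¹' S).indicator fun _ => 1) :=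
  bddCalc_apply (BddMeas.indicator (hζ hS)) x

theorem ProjectionMeasure.diag_apply (E : ProjectionMeasure H) (x : H) {S : Set ℂ}
    (hS : MeasurableSet S) : E.diag x S = ENNReal.ofReal (⟪x, E.proj S x⟫_ℂ).re :=
  Measure.ofMeasurable_apply S hS

theorem ProjectionMeasure.inner_proj (E : ProjectionMeasure H) (x : H) {S : Set ℂ}
    (hS : MeasurableSet S) : ⟪x, E.proj S x⟫_ℂ = (‖E.proj S x‖ ^ 2 : ℝ) := by
  have h := E.isStarProjection S hS
  have h1 : E.proj S x = E.proj S (E.proj S x) := by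
    conv_lhs => rw [← h.isIdempotentElem.eq]
    rfl
  have h2 : ContinuousLinearMap.adjoint (E.proj S) = E.proj S := h.isSelfAdjoint.star_eq
  rw [h1, ← ContinuousLinearMap.adjoint_inner_left, h2, ← h1]
  simp [inner_self_eq_norm_sq_to_K]

theorem ProjectionMeasure.diag_apply_eq_enorm (E : ProjectionMeasure H) (x : H) {S : Set ℂ}
    (hS : MeasurableSet S) : E.diag x S = ‖E.proj S x‖ₑ ^ 2 := by
  rw [E.diag_apply x hS, E.inner_proj x hS, Complex.ofReal_re, ENNReal.ofReal_pow (norm_nonneg _),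
    ofReal_norm]

theorem diag_projMeasure {ζ : K → ℂ} (hζ : Measurable ζ) (x : H) :
    (projMeasure φ ζ hζ).diag x = (diagMeasure φ x).map ζ := by
  ext S hS
  rw [ProjectionMeasure.diag_apply_eq_enorm _ x hS, projMeasure_apply hζ hS, Measure.map_apply hζ hS,
    enorm_specInt_sq ((BddMeas.indicator (hζ hS)).memLp _)]
  have (a : K) : ‖(ζ ⁻¹' S).indicator (fun _ => (1 : ℂ)) a‖ₑ ^ 2 = (ζ ⁻¹' S).indicator 1 a := by
    by_cases h : a ∈ ζ ⁻¹' S <;> simp [h]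
  simp_rw [this]
  exact lintegral_indicator_one (hζ hS)

end Unbounded

/-! ### Generators -/

section Generator

variable {K : Type*} [MetricSpace K] [CompactSpace K] [MeasurableSpace K] [BorelSpace K]
variable {H : Type*} [NormedAddCommGroup H] [InnerProductSpace ℂ H] [CompleteSpace H]
variable {φ : C(K, ℂ) →⋆ₐ[ℂ] (H →L[ℂ] H)} {w : C(K, ℂ)} {A : H →ₗ.[ℂ] H} {s : ℂ}
  {T : ℝ → H →L[ℂ] H}

theorem IsResolventAt.injective {R : H →L[ℂ] H} (hR : IsResolventAt A s R) :
    Function.Injective R := by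
  refine (injective_iff_map_eq_zero R).2 fun x hx => ?_
  obtain ⟨h, h1⟩ := hR.1 x
  have h2 : (⟨R x, h⟩ : A.domain) = 0 := Subtype.ext hx
  rw [h2, hx, A.map_zero, smul_zero, sub_zero] at h1
  exact h1.symm

theorem IsResolventAt.mem_domain_iff {R : H →L[ℂ] H} (hR : IsResolventAt A s R) (x : H) :
    x ∈ A.domain ↔ ∃ y, R y = x :=
  ⟨fun h => ⟨_, hR.2 ⟨x, h⟩⟩, by rintro ⟨y, rfl⟩; exact (hR.1 y).1⟩

theorem IsResolventAt.map_apply {R : H →L[ℂ] H} (hR : IsResolventAt A s R) (y : H)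
    (h : R y ∈ A.domain) : A ⟨R y, h⟩ = s • R y - y := by
  obtain ⟨h', h1⟩ := hR.1 y
  rw [eq_sub_iff_add_eq, add_comm, ← eq_sub_iff_add_eq]
  exact h1.symm

/-- The function on `K` that represents the operator with resolvent `φ w` at `s`. -/
def genFun (w : C(K, ℂ)) (s : ℂ) (k : K) : ℂ := s - (w k)⁻¹

theorem measurable_genFun : Measurable (genFun w s) :=
  measurable_const.sub w.continuous.measurable.inv

theorem genFun_mul (f : K → ℂ) : (fun k => genFun w s k * f k) = s • f - f / ⇑w := by
  ext k
  simp only [genFun, Pi.sub_apply, Pi.smul_apply, Pi.div_apply, smul_eq_mul]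
  ring

/-- Writing `f = w · (f/w)` almost everywhere exhibits the vector as `R y`, and `A R y = s R y - y`.
-/
theorem specInt_mem_domain (hR : IsResolventAt A s (φ w)) {x : H} {f : K → ℂ}
    (hf : MemLp f 2 (diagMeasure φ x)) (hfw : MemLp (f / ⇑w) 2 (diagMeasure φ x)) :
    ∃ h : specInt φ x f ∈ A.domain,
      A ⟨specInt φ x f, h⟩ = specInt φ x (fun k => genFun w s k * f k) := by
  have h1 := apply_specInt_div hR.injective hfw
  rw [genFun_mul, specInt_sub (hf.const_smul s) hfw, specInt_smul s hf, ← h1]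
  obtain ⟨h, -⟩ := hR.1 (specInt φ x (f / ⇑w))
  exact ⟨h, hR.map_apply _ h⟩

/-- The domain of `A` is the range of `φ w`, so `x` belongs to it iff `1/w ∈ L²(μ_x)`, i.e. iff `ζ =
s - 1/w` does. -/
theorem isSpectralMeasureOf_projMeasure (hR : IsResolventAt A s (φ w)) :
    IsSpectralMeasureOf (projMeasure φ (genFun w s) measurable_genFun) A := by
  have hone (x : H) : MemLp (fun _ => (1 : ℂ)) 2 (diagMeasure φ x) := memLp_const 1
  have hgen := genFun_mul (w := w) (s := s) fun _ => 1
  simp only [mul_one] at hgen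
  have hmem (x : H) : x ∈ A.domain ↔ MemLp ((fun _ => 1) / ⇑w) 2 (diagMeasure φ x) := by
    constructor
    · intro hx
      obtain ⟨y, hy⟩ := (hR.mem_domain_iff x).1 hx
      exact (memLp_div_of_apply_eq hR.injective (hone x) (hy.trans (specInt_one x).symm)).1
    · intro hx
      have := (specInt_mem_domain hR (hone x) hx).1
      rwa [specInt_one] at this
  constructor
  · intro x
    rw [hmem, diag_projMeasure, lintegral_map (by fun_prop) measurable_genFun,
      ← memLp_two_iff_lintegral_lt_top measurable_genFun.aestronglyMeasurable]
    change _ ↔ MemLp (fun k => genFun w s k) 2 _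
    rw [hgen]
    refine ⟨fun h => ((hone x).const_smul s).sub h, fun h => ?_⟩
    simpa using! ((hone x).const_smul s).sub h
  · rintro ⟨x, hx⟩
    have h1 := (hmem x).1 hx
    obtain ⟨h2, h3⟩ := specInt_mem_domain hR (hone x) h1
    simp only [specInt_one, mul_one] at h3
    rw [diag_projMeasure, integral_map measurable_genFun.aemeasurable
      (by fun_prop), h3]
    have h4 : MemLp (fun k => genFun w s k) 2 (diagMeasure φ x) := by
      rw [hgen]
      exact ((hone x).const_smul s).sub h1
    have h5 := inner_specInt (hone x) h4
    rw [specInt_one] at h5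
    rw [h5]
    simp

/-- The orbit of an element of the domain is differentiable from the right. -/
theorem hasDerivWithinAt_semigroup (hT : IsC0Semigroup T) (hA : IsGenerator A T)
    {x : H} (hx : x ∈ A.domain) {t : ℝ} (ht : 0 ≤ t) :
    HasDerivWithinAt (fun r => T r x) (T t (A ⟨x, hx⟩)) (Ici t) t := by
  rw [← hasDerivWithinAt_Ioi_iff_Ici, hasDerivWithinAt_iff_tendsto_slope' (by simp)]
  have h1 := (hA x (A ⟨x, hx⟩)).1 (A.mem_graph ⟨x, hx⟩)
  have h2 : Tendsto (fun r => r - t) (𝓝[>] t) (𝓝[>] 0) := by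
    refine tendsto_nhdsWithin_iff.2 ⟨?_, ?_⟩
    · have : Tendsto (fun r : ℝ => r - t) (𝓝 t) (𝓝 (t - t)) := by
        exact (continuous_id.sub continuous_const).tendsto t
      rw [sub_self] at this
      exact this.mono_left nhdsWithin_le_nhds
    · filter_upwards [self_mem_nhdsWithin] with r hr
      exact sub_pos.2 (mem_Ioi.1 hr)
  refine (((T t).continuous.tendsto _).comp (h1.comp h2)).congr' ?_
  filter_upwards [self_mem_nhdsWithin] with r hr
  have h3 : T r = T t * T (r - t) := by
    rw [← hT.map_add t (r - t) ht (sub_nonneg.2 (le_of_lt (mem_Ioi.1 hr))), add_sub_cancel]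
  simp only [Function.comp_apply, slope, vsub_eq_sub]
  rw [h3, (T t).map_smul_of_tower, map_sub, mul_apply_eq_comp]

/-- A bounded operator that commutes with the semigroup commutes with the resolvent. -/
theorem commute_resolvent {R : H →L[ℂ] H} (hA : IsGenerator A T)
    (hR : IsResolventAt A s R) {B : H →L[ℂ] H} (hB : ∀ t, 0 ≤ t → Commute B (T t)) :
    Commute B R := by
  refine ContinuousLinearMap.ext fun y => ?_
  rw [mul_apply_eq_comp, mul_apply_eq_comp]
  obtain ⟨h, h1⟩ := hR.1 y
  have h2 := (hA (R y) (A ⟨R y, h⟩)).1 (A.mem_graph ⟨R y, h⟩)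
  have h3 : (B (R y), B (A ⟨R y, h⟩)) ∈ A.graph := by
    rw [hA]
    refine ((B.continuous.tendsto _).comp h2).congr' ?_
    filter_upwards [self_mem_nhdsWithin] with r hr
    have := congr($((hB r (le_of_lt (mem_Ioi.1 hr))).eq) (R y))
    simp only [mul_apply_eq_comp] at this
    rw [Function.comp_apply, B.map_smul_of_tower, map_sub, this]
  obtain ⟨z, hz1, hz2⟩ := A.mem_graph_iff.1 h3
  have h4 := hR.2 z
  rw [hz1, hz2, ← map_smul, ← map_sub, h1] at h4
  exact h4.symm

end Generator

/-! ### The semigroup as a function of its generator -/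

section SemigroupCalculus

variable {K : Type*} [MetricSpace K] [CompactSpace K] [MeasurableSpace K] [BorelSpace K]
variable {H : Type*} [NormedAddCommGroup H] [InnerProductSpace ℂ H] [CompleteSpace H]
variable {φ : C(K, ℂ) →⋆ₐ[ℂ] (H →L[ℂ] H)} {w : C(K, ℂ)} {A : H →ₗ.[ℂ] H} {s : ℂ}
  {T : ℝ → H →L[ℂ] H}

/-- `e^{tζ}` on the set where `ζ` is bounded by `|s| + n + 1`. -/
def expTrunc (w : C(K, ℂ)) (s : ℂ) (n : ℕ) (t : ℝ) : K → ℂ :=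
  (truncSet w n).indicator fun k => Complex.exp (t * genFun w s k)

theorem norm_genFun_le {n : ℕ} {k : K} (hk : k ∈ truncSet w n) :
    ‖genFun w s k‖ ≤ ‖s‖ + (n + 1) :=
  (norm_sub_le _ _).trans (by gcongr; exact norm_inv_le_of_mem_truncSet hk)

theorem norm_expTrunc_le (n : ℕ) (t : ℝ) (k : K) :
    ‖expTrunc w s n t k‖ ≤ Real.exp (|t| * (‖s‖ + (n + 1))) := by
  by_cases hk : k ∈ truncSet w n
  · rw [expTrunc, indicator_of_mem hk, Complex.norm_exp]
    refine Real.exp_le_exp.2 ((Complex.re_le_norm _).trans ?_)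
    rw [norm_mul, Complex.norm_real, Real.norm_eq_abs]
    gcongr
    exact norm_genFun_le hk
  · rw [expTrunc, indicator_of_notMem hk, norm_zero]
    positivity

theorem bddMeas_expTrunc (n : ℕ) (t : ℝ) : BddMeas (expTrunc w s n t) :=
  ⟨(Complex.measurable_exp.comp (measurable_genFun.const_mul _)).indicator
    (measurableSet_truncSet n), _, norm_expTrunc_le n t⟩

theorem expTrunc_mul (n : ℕ) (t r : ℝ) :
    expTrunc w s n t * expTrunc w s n r = expTrunc w s n (t + r) := by
  ext k
  by_cases hk : k ∈ truncSet w n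
  · simp [expTrunc, hk, ← Complex.exp_add, add_mul]
  · simp [expTrunc, hk]

theorem expTrunc_zero (n : ℕ) :
    expTrunc w s n 0 = (truncSet w n).indicator fun _ => 1 := by
  ext k
  simp [expTrunc]

theorem bddMeas_genFun_mul_expTrunc (n : ℕ) (t : ℝ) :
    BddMeas fun k => genFun w s k * expTrunc w s n t k := by
  refine ⟨measurable_genFun.mul (bddMeas_expTrunc n t).1,
    (‖s‖ + (n + 1)) * Real.exp (|t| * (‖s‖ + (n + 1))), fun k => ?_⟩
  by_cases hk : k ∈ truncSet w n
  · rw [norm_mul]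
    exact mul_le_mul (norm_genFun_le hk) (norm_expTrunc_le n t k) (norm_nonneg _) (by positivity)
  · simp only [expTrunc, indicator_of_notMem hk, mul_zero, norm_zero]
    positivity

/-- On the truncation set `ζ` is bounded by `M`, so the second-order Taylor estimate of `exp` is
uniform and gives a derivative in operator norm. -/
theorem hasDerivAt_expTrunc (n : ℕ) (t : ℝ) :
    HasDerivAt (fun r => (bddCalc φ (expTrunc w s n r)).restrictScalars ℝ)
      ((bddCalc φ fun k => genFun w s k * expTrunc w s n t k).restrictScalars ℝ) t := by
  set M : ℝ := ‖s‖ + (n + 1) with hM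
  have hM0 : 0 < M := by positivity
  rw [hasDerivAt_iff_isLittleO]
  refine Asymptotics.IsBigO.trans_isLittleO ?_ (Asymptotics.isLittleO_pow_sub_sub t one_lt_two)
  refine Asymptotics.IsBigO.of_bound (Real.exp (|t| * M) * M ^ 2) ?_
  -- Radius `1/M` ensures `|(r - t) ζ| ≤ 1`, the range in which the quadratic remainder estimate for
  -- `exp` applies.
  filter_upwards [Metric.ball_mem_nhds t (inv_pos.2 hM0)] with r hr
  rw [Metric.mem_ball, Real.dist_eq] at hr
  have hr1 : |r - t| * M ≤ 1 := 
    (mul_le_mul_of_nonneg_right hr.le hM0.le).trans_eq (inv_mul_cancel₀ hM0.ne')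
  refine ContinuousLinearMap.opNorm_le_bound _ (by positivity) fun x => ?_
  have hm (r : ℝ) := (bddMeas_expTrunc (w := w) (s := s) n r).memLp (diagMeasure φ x)
  have hd := (bddMeas_genFun_mul_expTrunc (w := w) (s := s) n t).memLp (diagMeasure φ x)
  have h1 : ((bddCalc φ (expTrunc w s n r)).restrictScalars ℝ -
      (bddCalc φ (expTrunc w s n t)).restrictScalars ℝ - (r - t) •
      (bddCalc φ fun k => genFun w s k * expTrunc w s n t k).restrictScalars ℝ) x =
      specInt φ x (expTrunc w s n r - expTrunc w s n t -
        ((r - t : ℝ) : ℂ) • fun k => genFun w s k * expTrunc w s n t k) := by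
    rw [specInt_sub ((hm r).sub (hm t)) (hd.const_smul _), specInt_sub (hm r) (hm t),
      specInt_smul _ hd, ← bddCalc_apply (bddMeas_expTrunc n r), ←
      bddCalc_apply (bddMeas_expTrunc n t), ← bddCalc_apply (bddMeas_genFun_mul_expTrunc n t)]
    simp [-Complex.ofReal_sub]
  rw [h1]
  refine norm_specInt_le (((bddMeas_expTrunc n r).1.sub (bddMeas_expTrunc n t).1).sub
    ((bddMeas_genFun_mul_expTrunc n t).1.const_smul _)) (fun k => ?_) x
  rw [norm_pow, norm_norm, Real.norm_eq_abs]
  by_cases hk : k ∈ truncSet w n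
  · have h2 := norm_genFun_le (s := s) hk
    have h3 : ‖((r - t : ℝ) : ℂ) * genFun w s k‖ ≤ |r - t| * M := by
      rw [norm_mul, Complex.norm_real, Real.norm_eq_abs]
      gcongr
    have h4 := Complex.norm_exp_sub_one_sub_id_le (h3.trans hr1)
    have h5 : (expTrunc w s n r - expTrunc w s n t -
        ((r - t : ℝ) : ℂ) • fun k => genFun w s k * expTrunc w s n t k) k =
        expTrunc w s n t k * (Complex.exp (((r - t : ℝ) : ℂ) * genFun w s k) - 1 -
          ((r - t : ℝ) : ℂ) * genFun w s k) := by
      have h6 : Complex.exp (r * genFun w s k) = Complex.exp (t * genFun w s k) *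
          Complex.exp (((r - t : ℝ) : ℂ) * genFun w s k) := by
        rw [← Complex.exp_add]
        congr 1
        push_cast
        ring
      simp only [Pi.sub_apply, Pi.smul_apply, expTrunc, indicator_of_mem hk, smul_eq_mul, h6]
      ring
    rw [h5, norm_mul, mul_assoc]
    refine mul_le_mul (norm_expTrunc_le n t k) (h4.trans ?_) (norm_nonneg _) (by positivity)
    rw [← mul_pow, mul_comm M]
    gcongr
  · have h5 : (expTrunc w s n r - expTrunc w s n t -
        ((r - t : ℝ) : ℂ) • fun k => genFun w s k * expTrunc w s n t k) k = 0 := by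
      simp [expTrunc, hk]
    rw [h5, norm_zero]
    positivity

/-- The usual uniqueness argument for `v' = A v`: the truncated vector lies in `D(A)`, and `e^{-rζ}
T(r) v` has zero right derivative by the product rule, so it is constant on `[0,t]`. -/
theorem semigroup_specInt_trunc (hR : IsResolventAt A s (φ w)) (hT : IsC0Semigroup T)
    (hA : IsGenerator A T) (hc : ∀ t, 0 ≤ t → ∀ g, Commute (T t) (φ g)) {t : ℝ} (ht : 0 ≤ t)
    (n : ℕ) (x : H) :
    T t (specInt φ x ((truncSet w n).indicator fun _ => 1)) = specInt φ x (expTrunc w s n t) := by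
  have h1b := BddMeas.indicator (measurableSet_truncSet (w := w) n)
  set v := specInt φ x ((truncSet w n).indicator fun _ => 1) with hv
  have hvt (r : ℝ) : specInt φ v (expTrunc w s n r) = specInt φ x (expTrunc w s n r) := by
    rw [hv, specInt_specInt (bddMeas_expTrunc n r) (h1b.memLp _), ← expTrunc_zero (s := s),
      expTrunc_mul, add_zero]
  have hdiv : BddMeas (((truncSet w n).indicator fun _ => 1) / ⇑w) := by
    refine ⟨h1b.1.div w.continuous.measurable, n + 1, fun k => ?_⟩
    by_cases hk : k ∈ truncSet w n
    · simpa [hk] using norm_inv_le_of_mem_truncSet hk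
    · simp only [Pi.div_apply, indicator_of_notMem hk, zero_div, norm_zero]
      positivity
  obtain ⟨hvA, hAv⟩ := specInt_mem_domain hR (h1b.memLp _) (hdiv.memLp (diagMeasure φ x))
  replace hAv : A ⟨v, hvA⟩ = specInt φ x fun k => genFun w s k * expTrunc w s n 0 k := by
    rw [expTrunc_zero]
    exact hAv
  have key : ∀ r ∈ Icc 0 t, bddCalc φ (expTrunc w s n (-r)) (T r v) =
      bddCalc φ (expTrunc w s n (-0)) (T 0 v) := by
    refine constant_of_has_deriv_right_zero ?_ ?_
    · have h1 : Continuous fun r : ℝ => (bddCalc φ (expTrunc w s n r)).restrictScalars ℝ :=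
        continuous_iff_continuousAt.2 fun r => (hasDerivAt_expTrunc n r).continuousAt
      exact ((h1.comp continuous_neg).continuousOn).clm_apply
        ((hT.continuousOn v).mono Icc_subset_Ici_self)
    · intro r hr
      have h1 := ((hasDerivAt_expTrunc (φ := φ) (w := w) (s := s) n (-r)).scomp r
        (hasDerivAt_neg r)).hasDerivWithinAt (s := Ici r)
      have h2 := h1.clm_apply (hasDerivWithinAt_semigroup hT hA hvA hr.1)
      convert! h2 using 1
      simp only [Function.comp_apply, neg_smul, one_smul, neg_apply, ContinuousLinearMap.coe_restrictScalars']
      have h3 : specInt φ v (fun k => genFun w s k * expTrunc w s n (-r) k) =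
          specInt φ (specInt φ x fun k => genFun w s k * expTrunc w s n 0 k)
            (expTrunc w s n (-r)) := by
        rw [hv, specInt_specInt (bddMeas_genFun_mul_expTrunc n (-r)) (h1b.memLp _),
          specInt_specInt (bddMeas_expTrunc n (-r)) ((bddMeas_genFun_mul_expTrunc n 0).memLp _)]
        congr 1
        ext k
        by_cases hk : k ∈ truncSet w n
        · simp [expTrunc, hk, mul_comm]
        · simp [expTrunc, hk]
      rw [hAv, bddCalc_apply (bddMeas_genFun_mul_expTrunc n (-r)),
        bddCalc_apply (bddMeas_expTrunc n (-r)),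
        ← specInt_commute (bddMeas_genFun_mul_expTrunc n (-r)) _ (hc r hr.1),
        ← specInt_commute (bddMeas_expTrunc n (-r)) _ (hc r hr.1), h3, neg_add_cancel]
  -- Multiplying by the truncated `e^{tζ}` undoes `e^{-tζ}`; the remaining cutoff acts trivially on
  -- `v`.
  have h2 := congr(bddCalc φ (expTrunc w s n t) $(key t ⟨ht, le_rfl⟩))
  rw [hT.map_zero, neg_zero, one_apply_eq_self, bddCalc_apply (bddMeas_expTrunc n (-t)),
    bddCalc_apply (bddMeas_expTrunc n 0), bddCalc_apply (bddMeas_expTrunc n t),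
    bddCalc_apply (bddMeas_expTrunc n t),
    specInt_specInt (bddMeas_expTrunc n t) ((bddMeas_expTrunc n _).memLp _),
    specInt_specInt (bddMeas_expTrunc n t) ((bddMeas_expTrunc n _).memLp _), expTrunc_mul,
    expTrunc_mul, add_neg_cancel, add_zero, hvt, ← specInt_commute (bddMeas_expTrunc n _) _ (hc t ht),
    hvt, expTrunc_zero] at h2
  exact h2

/-- `T(t) x = ∫ e^{tζ} dE x`. -/
theorem semigroup_eq_specInt (hR : IsResolventAt A s (φ w)) (hT : IsC0Semigroup T)
    (hA : IsGenerator A T) (hc : ∀ t, 0 ≤ t → ∀ g, Commute (T t) (φ g)) {t : ℝ} (ht : 0 ≤ t)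
    (x : H) :
    MemLp (fun k => Complex.exp (t * genFun w s k)) 2 (diagMeasure φ x) ∧
      T t x = specInt φ x fun k => Complex.exp (t * genFun w s k) := by
  have hmeas : Measurable fun k => Complex.exp (t * genFun w s k) :=
    Complex.measurable_exp.comp (measurable_genFun.const_mul _)
  have h1b (n : ℕ) := BddMeas.indicator (measurableSet_truncSet (w := w) n)
  have hmem : MemLp (fun k => Complex.exp (t * genFun w s k)) 2 (diagMeasure φ x) := by
    rw [memLp_two_iff_lintegral_lt_top hmeas.aestronglyMeasurable,
      lintegral_eq_iSup_truncSet hR.injective]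
    -- The truncations of `e^{tζ}` are `T(t)` applied to truncations of `x`, so their norms are at
    -- most `‖T(t)‖ ‖x‖`; no prior upper bound on `Re ζ` is needed.
    refine lt_of_le_of_lt (iSup_le (a := (‖T t‖ₑ * ‖x‖ₑ) ^ 2) fun n => ?_)
      (ENNReal.pow_lt_top (ENNReal.mul_lt_top (by simp) (by simp)))
    have h1 := enorm_specInt_sq ((bddMeas_expTrunc (w := w) (s := s) n t).memLp (diagMeasure φ x))
    rw [← lintegral_indicator (measurableSet_truncSet n)]
    refine le_of_eq_of_le (Eq.trans (lintegral_congr fun k => ?_) h1.symm) ?_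
    · by_cases hk : k ∈ truncSet w n <;> simp [expTrunc, hk]
    · rw [← semigroup_specInt_trunc hR hT hA hc ht]
      gcongr
      refine ((T t).le_opENorm _).trans ?_
      gcongr
      have h2 := norm_specInt_le (φ := φ) (C := 1) (h1b n).1 (fun k => ?_) x
      · rw [one_mul] at h2
        rwa [enorm_le_iff_norm_le]
      · by_cases hk : k ∈ truncSet w n <;> simp [hk]
  refine ⟨hmem, sub_eq_zero.1 (eq_zero_of_specInt_truncSet hR.injective fun n => ?_)⟩
  rw [← bddCalc_apply (h1b n), map_sub, bddCalc_apply (h1b n), bddCalc_apply (h1b n),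
    ← specInt_commute (h1b n) _ (hc t ht), semigroup_specInt_trunc hR hT hA hc ht,
    specInt_specInt (h1b n) hmem, sub_eq_zero]
  congr 1
  ext k
  by_cases hk : k ∈ truncSet w n <;> simp [expTrunc, hk]

end SemigroupCalculus

/-! ### Normality of the resolvent, and the spectrum of the generator -/

section Normal

variable {H : Type*} [NormedAddCommGroup H] [InnerProductSpace ℂ H] [CompleteSpace H]
variable {A : H →ₗ.[ℂ] H} {s : ℂ} {T : ℝ → H →L[ℂ] H} {R : H →L[ℂ] H}

theorem IsC0Semigroup.commute (hT : IsC0Semigroup T) {t r : ℝ} (ht : 0 ≤ t) (hr : 0 ≤ r) :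
    Commute (T t) (T r) := by
  rw [commute_iff_eq, ← hT.map_add t r ht hr, ← hT.map_add r t hr ht, add_comm]

theorem commute_semigroup_resolvent (hT : IsC0Semigroup T) (hA : IsGenerator A T)
    (hR : IsResolventAt A s R) {t : ℝ} (ht : 0 ≤ t) : Commute (T t) R :=
  commute_resolvent hA hR fun _ hr => hT.commute ht hr

/-- Fuglede's theorem: what commutes with the normal operator `T(t)` commutes with its adjoint; then
take adjoints. -/
theorem commute_star_resolvent_semigroup (hT : IsC0Semigroup T)
    (hTn : ∀ t : ℝ, 0 ≤ t → IsStarNormal (T t)) (hA : IsGenerator A T)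
    (hR : IsResolventAt A s R) {t : ℝ} (ht : 0 ≤ t) : Commute (star R) (T t) := by
  have h := ((hTn t ht).commute_star_left (commute_semigroup_resolvent hT hA hR ht)).star_star
  rw [star_star] at h
  exact h.symm

theorem isStarNormal_resolvent (hT : IsC0Semigroup T)
    (hTn : ∀ t : ℝ, 0 ≤ t → IsStarNormal (T t)) (hA : IsGenerator A T)
    (hR : IsResolventAt A s R) : IsStarNormal R :=
  ⟨commute_resolvent hA hR fun _ ht => commute_star_resolvent_semigroup hT hTn hA hR ht⟩

theorem resolvent_identity (hR : IsResolventAt A s R) {z : ℂ} {Q : H →L[ℂ] H}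
    (hQ : IsResolventAt A z Q) (y : H) : Q y = R y + (s - z) • R (Q y) := by
  obtain ⟨h, h1⟩ := hQ.1 y
  have h2 := hR.2 ⟨Q y, h⟩
  have h3 : s • Q y - A ⟨Q y, h⟩ = y + (s - z) • Q y := by
    rw [hQ.map_apply]
    module
  rw [h3, map_add, map_smul] at h2
  exact h2.symm

/-- With `Q = (z - A)⁻¹` and `k = 1/(s - z)`, the resolvent identity shows that `k⁻¹ (1 + k⁻¹ Q)`
inverts `k - R`. -/
theorem inv_sub_notMem_spectrum (hR : IsResolventAt A s R) {z : ℂ} (hz : z ∈ opResolventSet A)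
    {k : ℂ} (hk : k ≠ 0) (hkz : s - k⁻¹ = z) : k ∉ spectrum ℂ R := by
  obtain ⟨Q, hQ⟩ := hz
  have hsz : s - z = k⁻¹ := by rw [← hkz]; ring
  have h1 (y : H) := resolvent_identity hR hQ y
  have h2 (y : H) := resolvent_identity hQ hR y
  rw [hsz] at h1
  rw [show z - s = -k⁻¹ by rw [← hsz]; ring] at h2
  rw [spectrum.notMem_iff, isUnit_iff_exists]
  refine ⟨k⁻¹ • (1 + k⁻¹ • Q), ?_, ?_⟩
  · refine ContinuousLinearMap.ext fun y => ?_
    simp only [mul_apply_eq_comp, sub_apply, add_apply, smul_apply, one_apply_eq_self,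
      Algebra.algebraMap_eq_smul_one, map_smul, map_add, smul_add, smul_smul]
    have h4 : (k⁻¹ * k⁻¹) • R (Q y) = k⁻¹ • (Q y - R y) := by
      rw [mul_smul, eq_sub_iff_add_eq'.2 (h1 y).symm]
    rw [smul_sub, smul_sub, h4, smul_smul, smul_smul, inv_mul_cancel₀ hk, mul_assoc,
      inv_mul_cancel₀ hk]
    module
  · refine ContinuousLinearMap.ext fun y => ?_
    simp only [mul_apply_eq_comp, sub_apply, add_apply, smul_apply, one_apply_eq_self,
      Algebra.algebraMap_eq_smul_one, map_smul, map_sub, smul_add, smul_smul]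
    have h4 : (k⁻¹ * k⁻¹) • Q (R y) = k⁻¹ • (Q y - R y) := by
      have h3 := h2 y
      rw [neg_smul, ← sub_eq_add_neg] at h3
      rw [mul_smul, eq_sub_iff_add_eq'.2 (sub_eq_iff_eq_add.1 h3.symm).symm]
    rw [h4, mul_inv_cancel₀ hk, show k * (k⁻¹ * k⁻¹) = k⁻¹ by field_simp]
    module

theorem neg_mem_opResolventSet {z : ℂ} (hz : z ∈ opResolventSet (-A)) : -z ∈ opResolventSet A := by
  obtain ⟨Q, h1, h2⟩ := hz
  refine ⟨-Q, fun x => ?_, fun x => ?_⟩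
  · obtain ⟨h, h3⟩ := h1 x
    have h' : Q x ∈ A.domain := h
    have h4 : (⟨-Q x, A.domain.neg_mem h'⟩ : A.domain) = -⟨Q x, h'⟩ := rfl
    refine ⟨A.domain.neg_mem h', ?_⟩
    change -z • -Q x - A ⟨-Q x, A.domain.neg_mem h'⟩ = x
    rw [h4, A.map_neg]
    rw [LinearPMap.neg_apply] at h3
    conv_rhs => rw [← h3]
    rw [neg_smul_neg]
  · have h3 := h2 x
    rw [LinearPMap.neg_apply, sub_neg_eq_add] at h3
    change -Q (-z • (x : H) - A x) = x
    rw [← map_neg]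
    refine Eq.trans ?_ h3
    congr 1
    module

end Normal

/-! ### Uniqueness of the spectral measure -/

section Uniqueness

variable {H : Type*} [NormedAddCommGroup H] [InnerProductSpace ℂ H] [CompleteSpace H]
variable {A : H →ₗ.[ℂ] H} {s : ℂ} {R : H →L[ℂ] H} {E F : ProjectionMeasure H}
variable {S S' : Set ℂ} {x y : H}

theorem ProjectionMeasure.proj_comm (E : ProjectionMeasure H) (hS : MeasurableSet S)
    (hS' : MeasurableSet S') (x : H) : E.proj S (E.proj S' x) = E.proj S' (E.proj S x) := by
  rw [← mul_apply_eq_comp, ← mul_apply_eq_comp, ← E.inter _ _ hS hS', inter_comm,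
    E.inter _ _ hS' hS]

theorem ProjectionMeasure.inner_proj_left (E : ProjectionMeasure H) (hS : MeasurableSet S)
    (x y : H) : ⟪E.proj S x, y⟫_ℂ = ⟪x, E.proj S y⟫_ℂ := by
  have h : ContinuousLinearMap.adjoint (E.proj S) = E.proj S :=
    (E.isStarProjection S hS).isSelfAdjoint.star_eq
  conv_lhs => rw [← h]
  exact ContinuousLinearMap.adjoint_inner_left _ _ _

theorem ProjectionMeasure.proj_add_compl (E : ProjectionMeasure H) (hS : MeasurableSet S) (x : H) :
    E.proj S x + E.proj Sᶜ x = x := by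
  have h := E.hasSum_iUnion (fun n => if n = 0 then S else if n = 1 then Sᶜ else ∅)
    (fun n => by split_ifs <;> simp [hS, hS.compl]) (fun i j hij => by
      simp only [Function.onFun]
      split_ifs <;> simp_all [disjoint_compl_left, disjoint_compl_right]) x
  have h1 : ⋃ n : ℕ, (if n = 0 then S else if n = 1 then Sᶜ else ∅) = Set.univ := by
    refine eq_univ_of_forall fun z => ?_
    by_cases hz : z ∈ S
    · exact mem_iUnion.2 ⟨0, by simpa using hz⟩
    · exact mem_iUnion.2 ⟨1, by simpa using hz⟩
  rw [h1, E.univ, one_apply_eq_self] at h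
  refine Eq.symm (h.unique ?_)
  have h2 := hasSum_sum_of_ne_finset_zero (s := {0, 1}) (L := SummationFilter.unconditional ℕ)
    (f := fun n : ℕ => E.proj (if n = 0 then S else if n = 1 then Sᶜ else ∅) x) (by
      intro n hn
      simp only [Finset.mem_insert, Finset.mem_singleton, not_or] at hn
      simp [hn, E.empty])
  simpa using h2

theorem ProjectionMeasure.proj_proj_self (E : ProjectionMeasure H) (hS : MeasurableSet S) (x : H) :
    E.proj S (E.proj S x) = E.proj S x := by
  rw [← mul_apply_eq_comp, (E.isStarProjection S hS).isIdempotentElem.eq]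

theorem ProjectionMeasure.proj_proj_compl (E : ProjectionMeasure H) (hS : MeasurableSet S) (x : H) :
    E.proj S (E.proj Sᶜ x) = 0 := by
  rw [← mul_apply_eq_comp, ← E.inter _ _ hS hS.compl, inter_compl_self, E.empty]
  rfl

instance (E : ProjectionMeasure H) (x : H) : IsFiniteMeasure (E.diag x) :=
  ⟨by rw [E.diag_apply_eq_enorm x .univ, E.univ]; simp⟩

theorem ProjectionMeasure.diag_proj (E : ProjectionMeasure H) (hS : MeasurableSet S) (x : H) :
    E.diag (E.proj S x) = (E.diag x).restrict S := by
  ext S' hS'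
  rw [Measure.restrict_apply hS', E.diag_apply_eq_enorm _ hS',
    E.diag_apply_eq_enorm _ (hS'.inter hS), E.inter _ _ hS' hS, mul_apply_eq_comp]

/-- Vectors in the ranges of `E(S)` and `E(Sᶜ)` stay orthogonal under every projection of `E`, so
Pythagoras applies. -/
theorem ProjectionMeasure.diag_add (E : ProjectionMeasure H) (hS : MeasurableSet S)
    (hx : E.proj S x = x) (hy : E.proj Sᶜ y = y) : E.diag (x + y) = E.diag x + E.diag y := by
  ext S' hS'
  rw [Measure.add_apply, E.diag_apply_eq_enorm _ hS', E.diag_apply_eq_enorm _ hS',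
    E.diag_apply_eq_enorm _ hS', map_add]
  have h : ⟪E.proj S' x, E.proj S' y⟫_ℂ = 0 := by
    rw [← hx, ← hy, E.proj_comm hS' hS, E.proj_comm hS' hS.compl, E.inner_proj_left hS,
      E.proj_proj_compl hS, inner_zero_right]
  have h2 := norm_add_sq_eq_norm_sq_add_norm_sq_of_inner_eq_zero _ _ h
  simp_rw [← ofReal_norm, ← ENNReal.ofReal_pow (norm_nonneg _)]
  rw [← ENNReal.ofReal_add (by positivity) (by positivity)]
  congr 1
  simpa only [← pow_two] using h2

/-- Reduces to bounded sets, on which the range of a spectral projection lies in the domain of the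
operator. -/
theorem ProjectionMeasure.proj_eq_zero_of_forall_bounded (E : ProjectionMeasure H)
    (hS : MeasurableSet S) (h : ∀ n : ℕ, E.proj (S ∩ Metric.closedBall 0 n) x = 0) :
    E.proj S x = 0 := by
  have h1 : E.diag x S = 0 := by
    have h2 : S = ⋃ n : ℕ, S ∩ Metric.closedBall 0 n := by
      rw [← inter_iUnion, Metric.iUnion_closedBall_nat, inter_univ]
    rw [h2, measure_iUnion_null_iff]
    intro n
    rw [E.diag_apply_eq_enorm _ (hS.inter Metric.isClosed_closedBall.measurableSet), h n]
    simp
  rw [E.diag_apply_eq_enorm _ hS] at h1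
  simpa using h1

theorem IsSpectralMeasureOf.proj_mem (hE : IsSpectralMeasureOf E A) (hS : MeasurableSet S)
    (hx : x ∈ A.domain) : E.proj S x ∈ A.domain := by
  rw [hE.1, E.diag_proj hS]
  exact (setLIntegral_le_lintegral _ _).trans_lt ((hE.1 x).1 hx)

theorem IsSpectralMeasureOf.proj_mem_of_bounded (hE : IsSpectralMeasureOf E A)
    (hS : MeasurableSet S) (n : ℕ) : E.proj (S ∩ Metric.closedBall 0 n) x ∈ A.domain := by
  have hm : MeasurableSet (S ∩ Metric.closedBall (0 : ℂ) n) :=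
    hS.inter Metric.isClosed_closedBall.measurableSet
  rw [hE.1, E.diag_proj hm]
  refine lt_of_le_of_lt (setLIntegral_mono (g := fun _ => (n : ℝ≥0∞) ^ 2) measurable_const
    fun z hz => ?_) ?_
  · have : ‖z‖ ≤ n := by simpa using hz.2
    gcongr
    rw [← ofReal_norm, ← ENNReal.ofReal_natCast]
    exact ENNReal.ofReal_le_ofReal this
  · rw [lintegral_const]
    exact ENNReal.mul_lt_top (by finiteness) (measure_lt_top _ _)

theorem IsSpectralMeasureOf.integrable (hE : IsSpectralMeasureOf E A) (hx : x ∈ A.domain) :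
    Integrable (fun z => z) (E.diag x) :=
  ((memLp_two_iff_lintegral_lt_top (f := fun z : ℂ => z) (by fun_prop)).2
    ((hE.1 x).1 hx)).integrable (by simp)

/-- The defining relation only knows `⟨x, A x⟩`. Since `E.diag` is additive on `x + c y`, the cross
terms cancel for every `c`; taking `c = 1` and `c = i` separates them. -/
theorem IsSpectralMeasureOf.inner_eq_zero (hE : IsSpectralMeasureOf E A) (hS : MeasurableSet S)
    (x y : A.domain) (hx : E.proj S x = x) (hy : E.proj Sᶜ (y : H) = y) :
    ⟪(x : H), A y⟫_ℂ = 0 := by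
  have key (c : ℂ) : c * ⟪(x : H), A y⟫_ℂ + starRingEnd ℂ c * ⟪(y : H), A x⟫_ℂ = 0 := by
    have hcy : E.proj Sᶜ ((c • y : A.domain) : H) = (c • y : A.domain) := by
      rw [Submodule.coe_smul, map_smul, hy]
    have h1 := hE.2 (x + c • y)
    rw [Submodule.coe_add, E.diag_add hS hx hcy, integral_add_measure (hE.integrable x.2)
      (hE.integrable (c • y : A.domain).2), ← hE.2 x, ← hE.2 (c • y), A.map_add, inner_add_left,
      inner_add_right, inner_add_right] at h1
    rw [A.map_smul, Submodule.coe_smul, inner_smul_right, inner_smul_left (y : H)] at h1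
    linear_combination h1
  have h1 := key 1
  have h2 := key Complex.I
  simp only [map_one, one_mul, Complex.conj_I] at h1 h2
  have h3 : 2 * ⟪(x : H), A y⟫_ℂ = 0 := by
    linear_combination h1 - Complex.I * h2 -
      (⟪(x : H), A y⟫_ℂ - ⟪(y : H), A x⟫_ℂ) * (-Complex.I_mul_I)
  simpa using h3

/-- Test `A y` against its own projection onto a bounded part of `S`, which lies in the domain. -/
theorem IsSpectralMeasureOf.proj_map_compl (hE : IsSpectralMeasureOf E A) (hS : MeasurableSet S)
    (y : A.domain) (hy : E.proj Sᶜ (y : H) = y) : E.proj S (A y) = 0 := by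
  refine E.proj_eq_zero_of_forall_bounded hS fun n => ?_
  have hm : MeasurableSet (S ∩ Metric.closedBall (0 : ℂ) n) :=
    hS.inter Metric.isClosed_closedBall.measurableSet
  have h1 : E.proj S (E.proj (S ∩ Metric.closedBall 0 n) (A y)) =
      E.proj (S ∩ Metric.closedBall 0 n) (A y) := by
    rw [← mul_apply_eq_comp, ← E.inter _ _ hS hm, ← inter_assoc, inter_self]
  have h2 := hE.inner_eq_zero hS ⟨_, hE.proj_mem_of_bounded (x := A y) hS n⟩ y h1 hy
  rw [E.inner_proj_left hm, E.inner_proj _ hm] at h2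
  simpa using h2

theorem IsSpectralMeasureOf.map_proj (hE : IsSpectralMeasureOf E A) (hS : MeasurableSet S)
    (x : A.domain) : A ⟨E.proj S x, hE.proj_mem hS x.2⟩ = E.proj S (A x) := by
  have h1 : x = ⟨E.proj S x, hE.proj_mem hS x.2⟩ + ⟨E.proj Sᶜ x, hE.proj_mem hS.compl x.2⟩ :=
    Subtype.ext (E.proj_add_compl hS x).symm
  have h2 : E.proj S (A x) = E.proj S (A ⟨E.proj S x, hE.proj_mem hS x.2⟩) := by
    conv_lhs => rw [h1]
    rw [A.map_add, map_add, hE.proj_map_compl hS ⟨E.proj Sᶜ x, hE.proj_mem hS.compl x.2⟩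
      (E.proj_proj_self hS.compl x), add_zero]
  have h3 := hE.proj_map_compl hS.compl ⟨E.proj S x, hE.proj_mem hS x.2⟩
    (by rw [compl_compl]; exact E.proj_proj_self hS x)
  rw [h2]
  conv_lhs => rw [← E.proj_add_compl hS (A ⟨E.proj S x, hE.proj_mem hS x.2⟩)]
  rw [h3, add_zero]

theorem IsSpectralMeasureOf.commute_resolvent (hE : IsSpectralMeasureOf E A)
    (hR : IsResolventAt A s R) (hS : MeasurableSet S) : Commute (E.proj S) R := by
  refine ContinuousLinearMap.ext fun y => ?_
  rw [mul_apply_eq_comp, mul_apply_eq_comp]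
  obtain ⟨h, h1⟩ := hR.1 y
  have h2 := hR.2 ⟨E.proj S (R y), hE.proj_mem hS h⟩
  rw [hE.map_proj hS ⟨R y, h⟩, ← map_smul, ← map_sub, h1] at h2
  exact h2.symm

/-- For `v` in both ranges, `l⟨v, A v⟩ - a ‖v‖²` is the integral of `l - a` against both scalar
measures of `v`. It is `≤ 0` for `E`, while for `F` the integrand is positive almost everywhere;
hence `v = 0`. Commutation puts the vector in both ranges, and the ball puts it in the domain. -/
theorem IsSpectralMeasureOf.proj_halfspace_compl (hE : IsSpectralMeasureOf E A)
    (hF : IsSpectralMeasureOf F A)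
    (hc : ∀ S S', MeasurableSet S → MeasurableSet S' → Commute (E.proj S) (F.proj S'))
    (l : ℂ →L[ℝ] ℝ) (a : ℝ) (x : H) : F.proj (l ⁻¹' Iic a)ᶜ (E.proj (l ⁻¹' Iic a) x) = 0 := by
  have hS : MeasurableSet (l ⁻¹' Iic a) := l.continuous.measurable measurableSet_Iic
  refine F.proj_eq_zero_of_forall_bounded hS.compl fun n => ?_
  have hm : MeasurableSet ((l ⁻¹' Iic a)ᶜ ∩ Metric.closedBall (0 : ℂ) n) :=
    hS.compl.inter Metric.isClosed_closedBall.measurableSet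
  set v := F.proj ((l ⁻¹' Iic a)ᶜ ∩ Metric.closedBall (0 : ℂ) n) (E.proj (l ⁻¹' Iic a) x) with hv
  have hvA : v ∈ A.domain := hF.proj_mem_of_bounded hS.compl n
  have hvE : E.diag v = (E.diag v).restrict (l ⁻¹' Iic a) := by
    rw [← E.diag_proj hS, hv]
    congr 1
    rw [← mul_apply_eq_comp (E.proj _), (hc _ _ hS hm).eq, mul_apply_eq_comp, E.proj_proj_self hS]
  have hvF : F.diag v = (F.diag v).restrict ((l ⁻¹' Iic a)ᶜ ∩ Metric.closedBall (0 : ℂ) n) := by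
    rw [← F.diag_proj hm, hv, F.proj_proj_self hm]
  have hint (E : ProjectionMeasure H) (hE : IsSpectralMeasureOf E A) :
      ∫ z, (l z - a) ∂(E.diag v) = l ⟪v, A ⟨v, hvA⟩⟫_ℂ - a * ‖v‖ ^ 2 := by
    have h1 : (E.diag v).real univ = ‖v‖ ^ 2 := by
      rw [measureReal_def, E.diag_apply_eq_enorm _ .univ, E.univ]
      simp
    rw [integral_sub (l.integrable_comp (hE.integrable hvA)) (integrable_const a),
      l.integral_comp_comm (hE.integrable hvA), hE.2 ⟨v, hvA⟩, integral_const, h1, smul_eq_mul,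
      mul_comm a]
  have h1 : ∫ z, (l z - a) ∂(E.diag v) ≤ 0 := by
    rw [hvE]
    refine setIntegral_nonpos hS fun z hz => sub_nonpos.2 hz
  have hpos : ∀ᵐ z ∂(F.diag v), 0 < l z - a := by
    rw [hvF]
    filter_upwards [ae_restrict_mem hm] with z hz
    have : ¬ l z ≤ a := hz.1
    linarith
  have h2 : ∫ z, (l z - a) ∂(F.diag v) = 0 := by
    refine le_antisymm ?_ (integral_nonneg_of_ae (hpos.mono fun z hz => hz.le))
    rw [hint F hF, ← hint E hE]
    exact h1
  rw [integral_eq_zero_iff_of_nonneg_ae (hpos.mono fun z hz => hz.le)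
    ((l.integrable_comp (hF.integrable hvA)).sub (integrable_const a))] at h2
  have h3 : ∀ᵐ z ∂(F.diag v), False := by
    filter_upwards [h2, hpos] with z hz hz'
    exact hz'.ne' hz
  have h4 : F.diag v univ = 0 := by simpa [ae_iff] using h3
  rw [F.diag_apply_eq_enorm _ .univ, F.univ] at h4
  simpa using h4

theorem IsSpectralMeasureOf.proj_halfspace_eq (hE : IsSpectralMeasureOf E A)
    (hF : IsSpectralMeasureOf F A)
    (hc : ∀ S S', MeasurableSet S → MeasurableSet S' → Commute (E.proj S) (F.proj S'))
    (l : ℂ →L[ℝ] ℝ) (a : ℝ) (x : H) : E.proj (l ⁻¹' Iic a) x = F.proj (l ⁻¹' Iic a) x := by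
  have hS : MeasurableSet (l ⁻¹' Iic a) := l.continuous.measurable measurableSet_Iic
  have h1 := F.proj_add_compl hS (E.proj (l ⁻¹' Iic a) x)
  have h2 := E.proj_add_compl hS (F.proj (l ⁻¹' Iic a) x)
  rw [hE.proj_halfspace_compl hF hc, add_zero] at h1
  rw [hF.proj_halfspace_compl hE (fun S S' hS hS' => (hc S' S hS' hS).symm), add_zero] at h2
  have h3 : E.proj (l ⁻¹' Iic a) (F.proj (l ⁻¹' Iic a) x) =
      F.proj (l ⁻¹' Iic a) (E.proj (l ⁻¹' Iic a) x) := congr($((hc _ _ hS hS).eq) x)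
  rw [← h1, ← h3, h2]

/-- Half-lines determine finite measures on `ℝ`, and the quadratic forms of the projections
determine the projections by polarization. -/
theorem IsSpectralMeasureOf.proj_preimage_eq (hE : IsSpectralMeasureOf E A)
    (hF : IsSpectralMeasureOf F A)
    (hc : ∀ S S', MeasurableSet S → MeasurableSet S' → Commute (E.proj S) (F.proj S'))
    (l : ℂ →L[ℝ] ℝ) {t : Set ℝ} (ht : MeasurableSet t) : E.proj (l ⁻¹' t) = F.proj (l ⁻¹' t) := by
  have hl : Measurable l := l.continuous.measurable
  have h1 (x : H) : (E.diag x).map l = (F.diag x).map l := by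
    refine Measure.ext_of_Iic _ _ fun a => ?_
    rw [Measure.map_apply hl measurableSet_Iic, Measure.map_apply hl measurableSet_Iic,
      E.diag_apply_eq_enorm _ (hl measurableSet_Iic), F.diag_apply_eq_enorm _ (hl measurableSet_Iic),
      hE.proj_halfspace_eq hF hc]
  refine ContinuousLinearMap.coe_injective ((ext_inner_map _ _).1 fun x => ?_)
  have h2 := congr($(h1 x) t)
  rw [Measure.map_apply hl ht, Measure.map_apply hl ht, E.diag_apply_eq_enorm _ (hl ht),
    F.diag_apply_eq_enorm _ (hl ht)] at h2
  have h3 : ‖E.proj (l ⁻¹' t) x‖ₑ = ‖F.proj (l ⁻¹' t) x‖ₑ :=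
    le_antisymm ((ENNReal.pow_le_pow_left_iff two_ne_zero).1 h2.le)
      ((ENNReal.pow_le_pow_left_iff two_ne_zero).1 h2.ge)
  have h4 : ‖E.proj (l ⁻¹' t) x‖ = ‖F.proj (l ⁻¹' t) x‖ := by
    simpa only [toReal_enorm] using congr(ENNReal.toReal $h3)
  simp only [ContinuousLinearMap.coe_coe]
  rw [E.inner_proj_left (hl ht), F.inner_proj_left (hl ht), E.inner_proj _ (hl ht),
    F.inner_proj _ (hl ht), h4]

/-- Two commuting spectral measures of the same operator have the same scalar measures. -/
theorem IsSpectralMeasureOf.diag_eq (hE : IsSpectralMeasureOf E A)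
    (hF : IsSpectralMeasureOf F A)
    (hc : ∀ S S', MeasurableSet S → MeasurableSet S' → Commute (E.proj S) (F.proj S')) (x : H) :
    E.diag x = F.diag x := by
  -- Rectangles suffice; each is an intersection of preimages under `Re` and `Im`, and projections
  -- of intersections multiply.
  refine Complex.measurableEquivRealProd.map_measurableEquiv_injective (Measure.ext_prod ?_)
  intro t u ht hu
  have hre : MeasurableSet (Complex.reCLM ⁻¹' t) := Complex.reCLM.continuous.measurable ht
  have him : MeasurableSet (Complex.imCLM ⁻¹' u) := Complex.imCLM.continuous.measurable hu
  have h1 : Complex.measurableEquivRealProd ⁻¹' (t ×ˢ u) =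
      Complex.reCLM ⁻¹' t ∩ Complex.imCLM ⁻¹' u := rfl
  rw [MeasurableEquiv.map_apply, MeasurableEquiv.map_apply, h1,
    E.diag_apply_eq_enorm _ (hre.inter him), F.diag_apply_eq_enorm _ (hre.inter him),
    E.inter _ _ hre him, F.inter _ _ hre him, hE.proj_preimage_eq hF hc _ ht,
    hE.proj_preimage_eq hF hc _ hu]

end Uniqueness

/-! ### The extrapolation space as a copy of the original space -/

section Transport

variable {H H' : Type*} [NormedAddCommGroup H] [InnerProductSpace ℂ H] [CompleteSpace H]
  [NormedAddCommGroup H'] [InnerProductSpace ℂ H'] [CompleteSpace H']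

/-- Transport of a projection-valued measure along a unitary operator. -/
def ProjectionMeasure.conj (E : ProjectionMeasure H) (J : H' ≃ₗᵢ[ℂ] H) : ProjectionMeasure H' where
  proj S := (J.symm.toContinuousLinearEquiv : H →L[ℂ] H') ∘L E.proj S ∘L
    (J.toContinuousLinearEquiv : H' →L[ℂ] H)
  isStarProjection S hS := by
    constructor
    · refine ContinuousLinearMap.ext fun x => ?_
      have := congr($((E.isStarProjection S hS).isIdempotentElem.eq) (J x))
      simp only [mul_apply_eq_comp] at this
      simp [mul_apply_eq_comp, this]
    · rw [isSelfAdjoint_iff, ContinuousLinearMap.star_eq_adjoint]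
      refine ((ContinuousLinearMap.eq_adjoint_iff _ _).2 fun x y => ?_).symm
      have := E.inner_proj_left hS (J x) (J y)
      rw [← J.inner_map_map, ← J.inner_map_map x]
      simpa using this
  empty := by simp [E.empty]
  univ := by
    refine ContinuousLinearMap.ext fun x => ?_
    simp [E.univ]
  inter S S' hS hS' := by
    refine ContinuousLinearMap.ext fun x => ?_
    simp [E.inter S S' hS hS', mul_apply_eq_comp]
  hasSum_iUnion S hS hd x :=
    (E.hasSum_iUnion S hS hd (J x)).mapL (J.symm.toContinuousLinearEquiv : H →L[ℂ] H')

theorem ProjectionMeasure.diag_conj (E : ProjectionMeasure H) (J : H' ≃ₗᵢ[ℂ] H) (x : H') :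
    (E.conj J).diag x = E.diag (J x) := by
  ext S hS
  rw [(E.conj J).diag_apply_eq_enorm _ hS, E.diag_apply_eq_enorm _ hS]
  congr 1
  exact J.symm.enorm_map _

theorem IsSpectralMeasureOf.conj {E : ProjectionMeasure H} {A : H →ₗ.[ℂ] H}
    (hE : IsSpectralMeasureOf E A) (J : H' ≃ₗᵢ[ℂ] H) {B : H' →ₗ.[ℂ] H'}
    (hB : ∀ x y, (x, y) ∈ B.graph ↔ (J x, J y) ∈ A.graph) : IsSpectralMeasureOf (E.conj J) B := by
  have h1 (x : H') : x ∈ B.domain ↔ J x ∈ A.domain := by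
    constructor
    · intro hx
      exact A.mem_domain_of_mem_graph ((hB _ _).1 (B.mem_graph ⟨x, hx⟩))
    · intro hx
      have h2 := A.mem_graph ⟨J x, hx⟩
      rw [← J.apply_symm_apply (A ⟨J x, hx⟩)] at h2
      exact B.mem_domain_of_mem_graph ((hB _ _).2 h2)
  refine ⟨fun x => ?_, fun x => ?_⟩
  · rw [h1, hE.1, E.diag_conj]
  · obtain ⟨y, hy1, hy2⟩ := A.mem_graph_iff.1 ((hB _ _).1 (B.mem_graph x))
    have h2 := hE.2 y
    rw [hy1, hy2, J.inner_map_map] at h2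
    rw [h2, E.diag_conj]

end Transport

/-! ### The unitary from `X₋₁` onto `X` extending the resolvent -/

section ExtrapolationIso

variable {X : Type*} [NormedAddCommGroup X] [InnerProductSpace ℂ X] [CompleteSpace X]
variable {A : X →ₗ.[ℂ] X} {s : ℂ} {R : X →L[ℂ] X}

/-- The orthogonal complement of the range is the kernel of `R*`, which for normal `R` is contained
in the kernel of `R`. -/
theorem denseRange_of_isStarNormal (hRn : IsStarNormal R) (hR : Function.Injective R) :
    DenseRange R := by
  have h1 : (LinearMap.range R.toLinearMap)ᗮ = ⊥ := by
    rw [Submodule.eq_bot_iff]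
    intro x hx
    rw [Submodule.mem_orthogonal] at hx
    have h2 : ContinuousLinearMap.adjoint R x = 0 := by
      refine ext_inner_left ℂ fun y => ?_
      rw [ContinuousLinearMap.adjoint_inner_right, inner_zero_right]
      exact hx _ ⟨y, rfl⟩
    have h3 := congr($(hRn.star_comm_self.eq) x)
    rw [mul_apply_eq_comp, mul_apply_eq_comp, ContinuousLinearMap.star_eq_adjoint, h2, map_zero] at h3
    have h4 : ⟪R x, R x⟫_ℂ = 0 := by
      rw [← ContinuousLinearMap.adjoint_inner_right, h3, inner_zero_right]
    rw [inner_self_eq_zero, ← map_zero R] at h4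
    exact hR h4
  have h2 := Submodule.dense_iff_topologicalClosure_eq_top.2
    ((Submodule.topologicalClosure_eq_top_iff).2 h1)
  exact h2

variable (A s) in
theorem norm_embed (x : X) : ‖embed A s x‖ = ‖opResolvent A s x‖ :=
  UniformSpace.Completion.norm_coe (toPre A s x)

variable (A s) in
theorem denseRange_embed : DenseRange (embed A s) :=
  UniformSpace.Completion.denseRange_coe.comp (toPre A s).surjective.denseRange
    (UniformSpace.Completion.continuous_coe _)

variable (A s) in
/-- The extension of the resolvent to an isometry `X₋₁ → X`. -/
def extrapolationIsometry : Extrapolation A s →ₗᵢ[ℂ] X where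
  toLinearMap := ((opResolvent A s).toLinearMap.extendOfNorm (embed A s)).toLinearMap
  norm_map' y := by
    refine isClosed_property (denseRange_embed A s)
      (isClosed_eq (ContinuousLinearMap.continuous _).norm continuous_norm) (fun x => ?_) y
    refine Eq.trans ?_ (norm_embed A s x).symm
    exact congr(‖$(LinearMap.extendOfNorm_eq (denseRange_embed A s)
      ⟨1, fun x => by rw [one_mul]; exact (norm_embed A s x).ge⟩ x)‖)

theorem extrapolationIsometry_embed (x : X) :
    extrapolationIsometry A s (embed A s x) = opResolvent A s x :=
  LinearMap.extendOfNorm_eq (denseRange_embed A s)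
    ⟨1, fun x => by rw [one_mul]; exact (norm_embed A s x).ge⟩ x

theorem surjective_extrapolationIsometry (hd : DenseRange (opResolvent A s)) :
    Function.Surjective (extrapolationIsometry A s) := by
  rw [← range_eq_univ, ← (extrapolationIsometry A s).isometry.isClosedEmbedding.isClosed_range.closure_eq,
    ← dense_iff_closure_eq]
  refine hd.mono ?_
  rintro _ ⟨x, rfl⟩
  exact ⟨embed A s x, extrapolationIsometry_embed x⟩

/-- The unitary operator `X₋₁ → X` that extends the resolvent. -/
def extrapolationEquiv (hd : DenseRange (opResolvent A s)) : Extrapolation A s ≃ₗᵢ[ℂ] X :=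
  LinearIsometryEquiv.ofSurjective (extrapolationIsometry A s) (surjective_extrapolationIsometry hd)

theorem extrapolationEquiv_embed (hd : DenseRange (opResolvent A s)) (x : X) :
    extrapolationEquiv hd (embed A s x) = opResolvent A s x :=
  extrapolationIsometry_embed x

theorem IsResolventAt.mem_graph_iff (hR : IsResolventAt A s R) (p q : X) :
    (p, q) ∈ A.graph ↔ R (s • p - q) = p := by
  constructor
  · intro h
    obtain ⟨x, hx1, hx2⟩ := A.mem_graph_iff.1 h
    have := hR.2 x
    rwa [hx1, hx2] at this
  · intro h
    obtain ⟨h1, -⟩ := hR.1 (s • p - q)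
    have h2 := hR.map_apply _ h1
    rw [A.mem_graph_iff]
    refine ⟨⟨_, h1⟩, h, ?_⟩
    rw [h2, h, sub_sub_cancel]

/-- The graph of `A` is given by the closed condition `R (s p - q) = p`, which gives one inclusion.
For the other, `u ↦ (R u, s R u - u)` parametrizes the graph, and the parameters in the dense range
of `R` correspond under `J` to points of the embedded graph. -/
theorem mem_graph_extendedGenerator (hs : s ∈ opResolventSet A)
    (hd : DenseRange (opResolvent A s)) (x y : Extrapolation A s) :
    (x, y) ∈ (extendedGenerator A s).graph ↔
      (extrapolationEquiv hd x, extrapolationEquiv hd y) ∈ A.graph := by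
  have hR := isResolventAt_opResolvent hs
  set J := extrapolationEquiv hd with hJ
  set g := A.graph.map ((embed A s).prodMap (embed A s)) with hg
  have hJR (x : X) : J.symm (opResolvent A s x) = embed A s x := by
    rw [J.symm_apply_eq, extrapolationEquiv_embed]
  have key (p : Extrapolation A s × Extrapolation A s) :
      p ∈ g.topologicalClosure ↔ (J p.1, J p.2) ∈ A.graph := by
    constructor
    · intro hp
      rw [hR.mem_graph_iff]
      have hcl : IsClosed {p : Extrapolation A s × Extrapolation A s |
          opResolvent A s (s • J p.1 - J p.2) = J p.1} := by
        refine isClosed_eq ?_ ?_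
        · exact (opResolvent A s).continuous.comp
            (((J.continuous.comp continuous_fst).const_smul s).sub (J.continuous.comp continuous_snd))
        · exact J.continuous.comp continuous_fst
      refine closure_minimal ?_ hcl hp
      rintro _ ⟨⟨a, b⟩, hab, rfl⟩
      change opResolvent A s (s • J (embed A s a) - J (embed A s b)) = J (embed A s a)
      rw [hJ, extrapolationEquiv_embed, extrapolationEquiv_embed, ← map_smul, ← map_sub]
      exact congr(opResolvent A s $((hR.mem_graph_iff a b).1 hab))
    · intro hp
      rw [hR.mem_graph_iff] at hp
      let Θ (u : X) : Extrapolation A s × Extrapolation A s :=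
        (J.symm (opResolvent A s u), J.symm (s • opResolvent A s u - u))
      have hΘ : Continuous Θ := by
        refine (J.symm.continuous.comp (opResolvent A s).continuous).prodMk
          (J.symm.continuous.comp ?_)
        exact ((opResolvent A s).continuous.const_smul s).sub continuous_id
      have h1 : p = Θ (s • J p.1 - J p.2) := by
        refine Prod.ext ?_ ?_
        · change p.1 = J.symm _
          rw [hp, J.symm_apply_apply]
        · change p.2 = J.symm _
          rw [hp, sub_sub_cancel, J.symm_apply_apply]
      rw [h1]
      refine isClosed_property hd (p := fun u => Θ u ∈ g.topologicalClosure)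
        (g.isClosed_topologicalClosure.preimage hΘ) (fun a => ?_) _
      refine g.le_topologicalClosure ⟨(opResolvent A s a, s • opResolvent A s a - a), ?_, ?_⟩
      · exact (hR.mem_graph_iff _ _).2 (by rw [sub_sub_cancel])
      · refine Prod.ext ?_ ?_
        · exact (hJR _).symm
        · change embed A s (s • opResolvent A s a - a) =
            J.symm (s • opResolvent A s (opResolvent A s a) - opResolvent A s a)
          rw [← map_smul (opResolvent A s) s (opResolvent A s a), ← map_sub, hJR]
  change _ ∈ (g.topologicalClosure.toLinearPMap).graph ↔ _
  -- The closure defines an operator only if it is single-valued at `0`; this side condition is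
  -- inherited from `A` through `J`.
  rw [Submodule.toLinearPMap_graph_eq, key]
  rintro p hp h0
  have h1 := (key p).1 hp
  rw [h0, map_zero] at h1
  have h2 := A.graph_fst_eq_zero_snd h1 rfl
  exact J.map_eq_zero_iff.1 h2

theorem extrapolationEquiv_extendedSemigroup (hd : DenseRange (opResolvent A s))
    {T : ℝ → X →L[ℂ] X} {t : ℝ} (hc : Commute (T t) (opResolvent A s)) (y : Extrapolation A s) :
    extrapolationEquiv hd (extendedSemigroup A s T t y) = T t (extrapolationEquiv hd y) := by
  have hcx (x : X) : T t (opResolvent A s x) = opResolvent A s (T t x) := congr($(hc.eq) x)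
  -- The map on completions extends the given one only if that is uniformly continuous; here `T(t)`
  -- is Lipschitz for the weaker norm because it commutes with the resolvent.
  have huc : UniformContinuous fun x : PreExtrapolation A s =>
      toPre A s (T t ((toPre A s).symm x)) := by
    refine (LipschitzWith.of_dist_le_mul (K := ‖T t‖₊) fun x y => ?_).uniformContinuous
    rw [dist_eq_norm, dist_eq_norm, ← map_sub, ← map_sub, ← map_sub]
    change ‖opResolvent A s (T t ((toPre A s).symm (x - y)))‖ ≤
      ‖T t‖ * ‖opResolvent A s ((toPre A s).symm (x - y))‖
    rw [← hcx]
    exact (T t).le_opNorm _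
  refine isClosed_property (denseRange_embed A s) (isClosed_eq
    ((extrapolationEquiv hd).continuous.comp UniformSpace.Completion.continuous_map)
    ((T t).continuous.comp (extrapolationEquiv hd).continuous)) (fun x => ?_) y
  have h1 : extendedSemigroup A s T t (embed A s x) = embed A s (T t x) :=
    UniformSpace.Completion.map_coe huc (toPre A s x)
  change extrapolationEquiv hd (extendedSemigroup A s T t (embed A s x)) = _
  rw [h1, extrapolationEquiv_embed, Function.comp_apply, extrapolationEquiv_embed, hcx]

end ExtrapolationIso

/-! ### Boundedness of the Laplace transform -/

/-! ### Weak limits along an ultrafilter -/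

section WeakLimit

variable {H : Type*} [NormedAddCommGroup H] [InnerProductSpace ℂ H] [CompleteSpace H]

/-- Bounded scalar sequences converge along an ultrafilter; the limits form a bounded functional of
`g`, which the Riesz theorem represents. Fixing the ultrafilter makes the limit linear in further
parameters. -/
theorem exists_weak_limit (l : Ultrafilter ℕ) (h : ℕ → H) {M : ℝ} (hM : ∀ n, ‖h n‖ ≤ M) :
    ∃ y : H, ‖y‖ ≤ M ∧ ∀ g : H, Tendsto (fun n => ⟪h n, g⟫_ℂ) l (𝓝 ⟪y, g⟫_ℂ) := by
  have hM0 : 0 ≤ M := (norm_nonneg _).trans (hM 0)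
  have hb (n : ℕ) (g : H) : ‖⟪h n, g⟫_ℂ‖ ≤ M * ‖g‖ :=
    (norm_inner_le_norm _ _).trans (by gcongr; exact hM n)
  have h1 (g : H) : ∃ a : ℂ, ‖a‖ ≤ M * ‖g‖ ∧ Tendsto (fun n => ⟪h n, g⟫_ℂ) l (𝓝 a) := by
    obtain ⟨a, ha, hl⟩ := (isCompact_closedBall (0 : ℂ) (M * ‖g‖)).ultrafilter_le_nhds
      (l.map fun n => ⟪h n, g⟫_ℂ) (by
        rw [le_principal_iff]
        exact Filter.mem_map.2 (Filter.univ_mem' fun n => by simpa using hb n g))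
    exact ⟨a, by simpa using ha, hl⟩
  choose B hB hBl using h1
  let Bl : H →L[ℂ] ℂ := LinearMap.mkContinuous
    { toFun := B
      map_add' := fun g g' => tendsto_nhds_unique (hBl (g + g'))
        (((hBl g).add (hBl g')).congr fun n => (inner_add_right _ _ _).symm)
      map_smul' := fun c g => tendsto_nhds_unique (hBl (c • g))
        (((hBl g).const_mul c).congr fun n => (inner_smul_right _ _ _).symm) } M hB
  refine ⟨(InnerProductSpace.toDual ℂ H).symm Bl, ?_, fun g => ?_⟩
  · rw [LinearIsometryEquiv.norm_map]
    exact LinearMap.mkContinuous_norm_le _ hM0 _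
  · rw [InnerProductSpace.toDual_symm_apply]
    exact hBl g

/-- A bounded sequence of operators has a limit, in the weak operator topology, along an
ultrafilter. -/
theorem exists_weak_operator_limit {E : Type*} [NormedAddCommGroup E] [NormedSpace ℂ E]
    (l : Ultrafilter ℕ) (h : ℕ → E →ₗ[ℂ] H) {M : ℝ} (hM : ∀ n v, ‖h n v‖ ≤ M * ‖v‖) :
    ∃ L : E →L[ℂ] H, ∀ v g, Tendsto (fun n => ⟪h n v, g⟫_ℂ) l (𝓝 ⟪L v, g⟫_ℂ) := by
  choose L hL hLl using fun v => exists_weak_limit l (fun n => h n v) (M := M * ‖v‖) (hM · v)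
  refine ⟨LinearMap.mkContinuous
    { toFun := L
      map_add' := fun v v' => ext_inner_right ℂ fun g => ?_
      map_smul' := fun c v => ext_inner_right ℂ fun g => ?_ } M hL, hLl⟩
  · rw [inner_add_left]
    exact tendsto_nhds_unique (hLl (v + v') g)
      (((hLl v g).add (hLl v' g)).congr fun n => by rw [map_add, inner_add_left])
  · rw [RingHom.id_apply, inner_smul_left]
    exact tendsto_nhds_unique (hLl (c • v) g)
      (((hLl v g).const_mul _).congr fun n => by rw [map_smul, inner_smul_left])

/-- A weak limit in `L²` agrees with a pointwise limit. -/
theorem ae_eq_of_weak_limit {α : Type*} [MeasurableSpace α] {ν : Measure α} {l : Filter ℕ}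
    [l.NeBot] (hl : l ≤ atTop) {f : ℕ → Lp ℂ 2 ν} {y : Lp ℂ 2 ν} {M : ℝ} (hM : ∀ n, ‖f n‖ ≤ M)
    (hy : ∀ g, Tendsto (fun n => ⟪f n, g⟫_ℂ) l (𝓝 ⟪y, g⟫_ℂ)) {F : α → ℂ}
    (hF : ∀ᵐ a ∂ν, Tendsto (fun n => f n a) atTop (𝓝 (F a))) : y =ᵐ[ν] F := by
  have hFm : AEStronglyMeasurable F ν :=
    aestronglyMeasurable_of_tendsto_ae atTop (fun n => (Lp.aestronglyMeasurable (f n))) hF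
  have hF2 : MemLp F 2 ν := by
    refine ⟨hFm, lt_of_le_of_lt (Lp.eLpNorm_lim_le_liminf_eLpNorm
      (fun n => Lp.aestronglyMeasurable (f n)) F hF) ?_⟩
    refine lt_of_le_of_lt (b := ENNReal.ofReal M) ?_ ENNReal.ofReal_lt_top
    refine Filter.liminf_le_of_le (by isBoundedDefault) fun b hb => ?_
    obtain ⟨n, hn⟩ := hb.exists
    refine hn.trans ?_
    rw [← ENNReal.ofReal_toReal (Lp.memLp (f n)).eLpNorm_ne_top]
    exact ENNReal.ofReal_le_ofReal (hM n)
  set d : Lp ℂ 2 ν := y - hF2.toLp F with hd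
  -- On `S m` the sequence is dominated by `m |d|`, so testing against `1_{S m} d` has the
  -- integrable majorant `m |d|²` and gives `d = 0` there. A convergent sequence is bounded, so
  -- almost every point with `d ≠ 0` lies in some `S m`. No σ-finiteness of `ν` is used.
  let S (m : ℕ) : Set α := {a | ∀ n, ‖f n a‖ ≤ m * ‖d a‖}
  have hS (m : ℕ) : MeasurableSet (S m) := by
    have : S m = ⋂ n, {a | ‖f n a‖ ≤ m * ‖d a‖} := by ext; simp [S]
    rw [this]
    exact .iInter fun n => measurableSet_le (Lp.stronglyMeasurable (f n)).norm.measurable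
      ((Lp.stronglyMeasurable d).norm.measurable.const_mul _)
  have hd2 : Integrable (fun a => ‖d a‖ ^ 2) ν := (Lp.memLp d).integrable_norm_pow two_ne_zero
  have hz (m : ℕ) : ∀ᵐ a ∂ν, a ∈ S m → d a = 0 := by
    have hg : MemLp ((S m).indicator d) 2 ν := (Lp.memLp d).indicator (hS m)
    have h1 : Tendsto (fun n => ⟪f n, hg.toLp _⟫_ℂ) atTop (𝓝 ⟪hF2.toLp F, hg.toLp _⟫_ℂ) := by
      simp_rw [L2.inner_def]
      refine tendsto_integral_of_dominated_convergence (fun a => m * ‖d a‖ ^ 2)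
        (fun n => (L2.integrable_inner _ _).1) (hd2.const_mul _) (fun n => ?_) ?_
      · filter_upwards [hg.coeFn_toLp] with a ha
        rw [ha]
        by_cases haS : a ∈ S m
        · rw [indicator_of_mem haS]
          refine (norm_inner_le_norm _ _).trans ?_
          rw [pow_two, ← mul_assoc]
          exact mul_le_mul_of_nonneg_right (haS n) (norm_nonneg _)
        · rw [indicator_of_notMem haS, inner_zero_right, norm_zero]
          positivity
      · filter_upwards [hF, hF2.coeFn_toLp] with a ha ha'
        rw [ha']
        exact ha.inner tendsto_const_nhds
    have h2 : ⟪d, hg.toLp _⟫_ℂ = 0 := by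
      have h3 (x : Lp ℂ 2 ν) : ⟪d, x⟫_ℂ = ⟪y, x⟫_ℂ - ⟪hF2.toLp F, x⟫_ℂ := by
        rw [hd, inner_sub_left]
      rw [h3, sub_eq_zero]
      exact tendsto_nhds_unique (hy _) (h1.mono_left hl)
    have h3 : ∫ a in S m, ‖d a‖ ^ 2 ∂ν = 0 := by
      have h4 : ⟪d, hg.toLp _⟫_ℂ = ((∫ a in S m, ‖d a‖ ^ 2 ∂ν : ℝ) : ℂ) := by
        rw [L2.inner_def, ← integral_indicator (hS m), ← integral_complex_ofReal]
        refine integral_congr_ae ?_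
        filter_upwards [hg.coeFn_toLp] with a ha
        rw [ha]
        by_cases haS : a ∈ S m
        · simp only [indicator_of_mem haS]
          rw [inner_self_eq_norm_sq_to_K]
          simp
        · simp [haS]
      rw [h4] at h2
      exact_mod_cast h2
    rw [setIntegral_eq_zero_iff_of_nonneg_ae (ae_of_all _ fun a => by positivity)
      hd2.integrableOn] at h3
    have h5 := (ae_restrict_iff' (hS m)).1 h3
    filter_upwards [h5] with a ha haS
    simpa using ha haS
  have hd0 : ∀ᵐ a ∂ν, d a = 0 := by
    filter_upwards [ae_all_iff.2 hz, hF] with a ha haF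
    by_contra h0
    obtain ⟨C, hC⟩ := haF.norm.bddAbove_range
    obtain ⟨m, hm⟩ := exists_nat_ge (C / ‖d a‖)
    refine h0 (ha m fun n => (hC ⟨n, rfl⟩).trans ?_)
    rwa [div_le_iff₀ (norm_pos_iff.2 h0)] at hm
  filter_upwards [hd0, Lp.coeFn_sub y (hF2.toLp F), hF2.coeFn_toLp] with a h1 h2 h3
  rw [← hd, h1, Pi.sub_apply, h3] at h2
  exact sub_eq_zero.1 h2.symm

end WeakLimit

/-! ### Reduction to Laplace transforms over bounded intervals -/

section FiniteLaplace

/-- The Laplace transform of the restriction of `u` to `[0, t]`. -/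
def finLaplace (t : ℝ) (u : ℝ → ℂ) (z : ℂ) : ℂ :=
  ∫ r in Icc 0 t, Complex.exp (-z * r) * u r

/-- The uniform bound for Laplace transforms of functions with bounded support. -/
def FinLaplaceBounded (p : ℝ≥0∞) (ν : Measure ℂ) : Prop :=
  ∃ C : ℝ, ∀ t : ℝ, 0 ≤ t → ∀ u : ℝ → ℂ, MemLp u p (volume.restrict (Icc 0 t)) →
    eLpNorm (finLaplace t u) 2 ν ≤ ENNReal.ofReal C * eLpNorm u p (volume.restrict (Icc 0 t))

variable {p : ℝ≥0∞} {ν : Measure ℂ} {t : ℝ} {u v : ℝ → ℂ}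

theorem finLaplace_congr_ae (h : u =ᵐ[volume.restrict (Icc 0 t)] v) :
    finLaplace t u = finLaplace t v := by
  ext z
  refine integral_congr_ae ?_
  filter_upwards [h] with r hr
  rw [hr]

theorem stronglyMeasurable_finLaplace (hu : AEStronglyMeasurable u (volume.restrict (Icc 0 t))) :
    StronglyMeasurable (finLaplace t u) := by
  rw [finLaplace_congr_ae hu.ae_eq_mk]
  refine StronglyMeasurable.integral_prod_right
    (f := fun z r => Complex.exp (-z * (r : ℝ)) * hu.mk u r) ?_
  refine StronglyMeasurable.mul ?_ (hu.stronglyMeasurable_mk.comp_measurable measurable_snd)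
  exact Continuous.stronglyMeasurable (by fun_prop)

theorem integrableOn_of_memLp [hp : Fact (1 ≤ p)] (hu : MemLp u p (volume.restrict (Icc 0 t))) :
    IntegrableOn u (Icc 0 t) := hu.integrable hp.out

theorem integrableOn_exp_mul (hu : IntegrableOn u (Icc 0 t)) (z : ℂ) :
    IntegrableOn (fun r : ℝ => Complex.exp (-z * r) * u r) (Icc 0 t) :=
  IntegrableOn.continuousOn_mul (by fun_prop) hu isCompact_Icc

theorem finLaplace_add (hu : IntegrableOn u (Icc 0 t)) (hv : IntegrableOn v (Icc 0 t)) :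
    finLaplace t (u + v) = finLaplace t u + finLaplace t v := by
  ext z
  simp only [finLaplace, Pi.add_apply, mul_add]
  exact integral_add (integrableOn_exp_mul hu z) (integrableOn_exp_mul hv z)

theorem finLaplace_smul (c : ℂ) : finLaplace t (c • u) = c • finLaplace t u := by
  ext z
  simp only [finLaplace, Pi.smul_apply, smul_eq_mul, ← integral_const_mul]
  congr 1
  ext r
  ring

theorem restrict_Ici_restrict_Icc :
    (volume.restrict (Ici (0 : ℝ))).restrict (Icc 0 t) = volume.restrict (Icc 0 t) := by
  rw [Measure.restrict_restrict measurableSet_Icc, inter_eq_left.2 Icc_subset_Ici_self]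

theorem FinLaplaceBounded.laplaceBounded [hp : Fact (1 ≤ p)] (h : FinLaplaceBounded p ν) :
    LaplaceBounded p ν := by
  obtain ⟨C, hC⟩ := h
  have hmem (n : ℕ) (u : Lp ℂ p (volume.restrict (Ici (0 : ℝ)))) :
      MemLp u p (volume.restrict (Icc (0 : ℝ) n)) := by
    rw [← restrict_Ici_restrict_Icc]
    exact (Lp.memLp u).restrict _
  have hmem2 (n : ℕ) (u : Lp ℂ p (volume.restrict (Ici (0 : ℝ)))) :
      MemLp (finLaplace n u) 2 ν :=
    ⟨(stronglyMeasurable_finLaplace (hmem n u).1).aestronglyMeasurable,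
      (hC n n.cast_nonneg u (hmem n u)).trans_lt
        (ENNReal.mul_lt_top ENNReal.ofReal_lt_top (hmem n u).2)⟩
  have hae (n : ℕ) {u v : ℝ → ℂ} (h : u =ᵐ[volume.restrict (Ici (0 : ℝ))] v) :
      u =ᵐ[volume.restrict (Icc (0 : ℝ) n)] v := by
    rw [← restrict_Ici_restrict_Icc]
    exact ae_restrict_of_ae h
  let L (n : ℕ) : Lp ℂ p (volume.restrict (Ici (0 : ℝ))) →ₗ[ℂ] Lp ℂ 2 ν :=
    { toFun := fun u => (hmem2 n u).toLp _
      map_add' := fun u v => by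
        rw [← MemLp.toLp_add]
        refine MemLp.toLp_congr _ _ (Eq.eventuallyEq ?_)
        rw [← finLaplace_add (integrableOn_of_memLp (hmem n u)) (integrableOn_of_memLp (hmem n v))]
        exact finLaplace_congr_ae (hae n (Lp.coeFn_add u v))
      map_smul' := fun c u => by
        rw [RingHom.id_apply, ← MemLp.toLp_const_smul]
        refine MemLp.toLp_congr _ _ (Eq.eventuallyEq ?_)
        rw [← finLaplace_smul]
        exact finLaplace_congr_ae (hae n (Lp.coeFn_smul c u)) }
  have hL (n : ℕ) (u : Lp ℂ p (volume.restrict (Ici (0 : ℝ)))) : ‖L n u‖ ≤ max C 0 * ‖u‖ := by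
    change ‖(hmem2 n u).toLp _‖ ≤ _
    rw [Lp.norm_toLp, Lp.norm_def, ← ENNReal.toReal_ofReal (le_max_right C 0), ← ENNReal.toReal_mul]
    refine ENNReal.toReal_mono
      (ENNReal.mul_ne_top ENNReal.ofReal_ne_top (Lp.memLp u).eLpNorm_ne_top)
      ((hC n n.cast_nonneg u (hmem n u)).trans ?_)
    refine mul_le_mul' (ENNReal.ofReal_le_ofReal (le_max_left _ _)) ?_
    rw [← restrict_Ici_restrict_Icc]
    exact eLpNorm_mono_measure _ Measure.restrict_le_self
  -- A weak limit is taken because for `p = ∞` the truncations of `u` to `[0,n]` need not converge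
  -- to `u` in norm.
  obtain ⟨Λ, hΛ⟩ := exists_weak_operator_limit (hyperfilter ℕ) L hL
  refine ⟨Λ, fun u hu => ae_eq_of_weak_limit (Nat.hyperfilter_le_atTop) (fun n => hL n u) (hΛ u) ?_⟩
  filter_upwards [hu, ae_all_iff.2 fun n => (hmem2 n u).coeFn_toLp] with z hz hz'
  have h1 (n : ℕ) : L n u z = finLaplace n u z := hz' n
  simp_rw [h1]
  have h2 : ⋃ n : ℕ, Icc (0 : ℝ) n = Ici 0 := by
    ext r
    simp only [mem_iUnion, mem_Icc, mem_Ici, exists_and_left, and_iff_left_iff_imp]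
    exact fun _ => exists_nat_ge r
  have h3 := tendsto_setIntegral_of_monotone (μ := volume) (s := fun n : ℕ => Icc (0 : ℝ) n)
    (f := fun r : ℝ => Complex.exp (-z * r) * u r) (fun n => measurableSet_Icc)
    (fun m n hmn => Icc_subset_Icc_right (by exact_mod_cast hmn)) (by rwa [h2])
  rwa [h2] at h3

theorem LaplaceBounded.finLaplaceBounded [hp : Fact (1 ≤ p)] (h : LaplaceBounded p ν) :
    FinLaplaceBounded p ν := by
  obtain ⟨L, hL⟩ := h
  refine ⟨‖L‖, fun t ht u hu => ?_⟩
  have hn : eLpNorm ((Icc 0 t).indicator u) p (volume.restrict (Ici (0 : ℝ))) =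
      eLpNorm u p (volume.restrict (Icc 0 t)) := by
    rw [eLpNorm_indicator_eq_eLpNorm_restrict measurableSet_Icc, restrict_Ici_restrict_Icc]
  have hm : MemLp ((Icc 0 t).indicator u) p (volume.restrict (Ici (0 : ℝ))) := by
    rw [memLp_indicator_iff_restrict measurableSet_Icc, restrict_Ici_restrict_Icc]
    exact hu
  have h1 (z : ℂ) : (fun r : ℝ => Complex.exp (-z * r) * hm.toLp _ r)
      =ᵐ[volume.restrict (Ici (0 : ℝ))]
      (Icc 0 t).indicator fun r : ℝ => Complex.exp (-z * r) * u r := by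
    filter_upwards [hm.coeFn_toLp] with r hr
    rw [hr]
    by_cases h : r ∈ Icc 0 t <;> simp [h]
  have h2 : L (hm.toLp _) =ᵐ[ν] laplace (hm.toLp _) := by
    refine hL _ (ae_of_all _ fun z => ?_)
    rw [IntegrableOn, integrable_congr (h1 z), integrable_indicator_iff measurableSet_Icc,
      IntegrableOn, restrict_Ici_restrict_Icc]
    exact integrableOn_exp_mul (integrableOn_of_memLp hu) z
  have h3 : laplace (hm.toLp _) = finLaplace t u := by
    ext z
    rw [laplace, integral_congr_ae (h1 z), integral_indicator measurableSet_Icc,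
      restrict_Ici_restrict_Icc]
    rfl
  rw [← h3, ← eLpNorm_congr_ae h2, ← hn]
  have h4 := L.le_opNorm (hm.toLp _)
  rw [Lp.norm_def, Lp.norm_toLp] at h4
  rw [← ENNReal.ofReal_toReal (Lp.memLp (L (hm.toLp _))).eLpNorm_ne_top,
    ← ENNReal.ofReal_toReal hm.eLpNorm_ne_top, ← ENNReal.ofReal_mul (norm_nonneg _)]
  exact ENNReal.ofReal_le_ofReal h4

end FiniteLaplace

/-! ### Convolution with the semigroup -/

section Convolution

variable {K : Type*} [MetricSpace K] [CompactSpace K] [MeasurableSpace K] [BorelSpace K]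
variable {H : Type*} [NormedAddCommGroup H] [InnerProductSpace ℂ H] [CompleteSpace H]
variable {φ : C(K, ℂ) →⋆ₐ[ℂ] (H →L[ℂ] H)} {w : C(K, ℂ)} {A : H →ₗ.[ℂ] H} {s : ℂ}
  {T : ℝ → H →L[ℂ] H} {c : H} {t : ℝ} {u : ℝ → ℂ}

theorem norm_specInt_sq {x : H} {f : K → ℂ} (hf : MemLp f 2 (diagMeasure φ x)) :
    ‖specInt φ x f‖ ^ 2 = ∫ k, ‖f k‖ ^ 2 ∂(diagMeasure φ x) := by
  have h := inner_specInt hf hf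
  rw [inner_self_eq_norm_sq_to_K] at h
  have h1 (k : K) : f k * starRingEnd ℂ (f k) = ((‖f k‖ ^ 2 : ℝ) : ℂ) := by
    rw [Complex.mul_conj']
    simp
  simp_rw [h1, integral_complex_ofReal] at h
  refine Complex.ofReal_injective (Eq.trans ?_ h)
  push_cast
  rfl

theorem adjoint_specIntL_specIntL (x : H) (f : Lp ℂ 2 (diagMeasure φ x)) :
    ContinuousLinearMap.adjoint (specIntL φ x) (specIntL φ x f) = f := by
  refine ext_inner_left ℂ fun g => ?_
  rw [ContinuousLinearMap.adjoint_inner_right, inner_specIntL]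

theorem IsC0Semigroup.continuousOn_sub (hT : IsC0Semigroup T) (c : H) (t : ℝ) :
    ContinuousOn (fun τ => T (t - τ) c) (Icc 0 t) :=
  (hT.continuousOn c).comp (by fun_prop) fun _ hτ => sub_nonneg.2 hτ.2

/-- The Fubini kernel of the convolution is integrable. -/
theorem integrable_exp_mul_prod (hR : IsResolventAt A s (φ w)) (hT : IsC0Semigroup T)
    (hA : IsGenerator A T) (hc : ∀ t, 0 ≤ t → ∀ g, Commute (T t) (φ g)) (c : H)
    (hu : IntegrableOn u (Icc 0 t)) :
    Integrable (fun q : K × ℝ => Complex.exp ((t - q.2 : ℝ) * genFun w s q.1) * u q.2)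
      ((diagMeasure φ c).prod (volume.restrict (Icc 0 t))) := by
  -- `M` bounds `‖T(t-τ) c‖`, which is the `L²(μ_c)` norm of `e^{(t-τ)ζ}`; with `|e| ≤ 1 + |e|²` its
  -- `L¹` norm is at most `μ_c(K) + M²`.
  obtain ⟨M, hM⟩ := isCompact_Icc.exists_bound_of_continuousOn (hT.continuousOn_sub c t)
  have hmeas : AEStronglyMeasurable
      (fun q : K × ℝ => Complex.exp ((t - q.2 : ℝ) * genFun w s q.1) * u q.2)
      ((diagMeasure φ c).prod (volume.restrict (Icc 0 t))) := by
    refine AEStronglyMeasurable.mul ?_ hu.1.comp_snd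
    refine (Complex.measurable_exp.comp ?_).aestronglyMeasurable
    exact (Complex.measurable_ofReal.comp (measurable_const.sub measurable_snd)).mul
      (measurable_genFun.comp measurable_fst)
  have hτ {τ : ℝ} (hτ : τ ∈ Icc 0 t) := semigroup_eq_specInt hR hT hA hc (sub_nonneg.2 hτ.2) c
  rw [integrable_prod_iff' hmeas]
  constructor
  · filter_upwards [ae_restrict_mem measurableSet_Icc] with τ h
    exact ((hτ h).1.integrable (by simp)).mul_const _
  · refine Integrable.mono' (hu.norm.const_mul ((diagMeasure φ c).real univ + M ^ 2))
      hmeas.norm.prod_swap.integral_prod_right' ?_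
    filter_upwards [ae_restrict_mem measurableSet_Icc] with τ h
    obtain ⟨h1, h2⟩ := hτ h
    simp only [norm_mul]
    rw [integral_mul_const, norm_mul, norm_norm]
    refine mul_le_mul_of_nonneg_right ?_ (norm_nonneg _)
    have h3 : Integrable (fun k => ‖Complex.exp ((t - τ : ℝ) * genFun w s k)‖ ^ 2)
      (diagMeasure φ c) := h1.integrable_norm_pow two_ne_zero
    have h4 : ∫ k, ‖Complex.exp ((t - τ : ℝ) * genFun w s k)‖ ^ 2 ∂(diagMeasure φ c) ≤ M ^ 2 := by
      rw [← norm_specInt_sq h1, ← h2]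
      have := hM τ h
      gcongr
    rw [Real.norm_of_nonneg (integral_nonneg fun k => norm_nonneg _)]
    calc ∫ k, ‖Complex.exp ((t - τ : ℝ) * genFun w s k)‖ ∂(diagMeasure φ c)
        ≤ ∫ k, (1 + ‖Complex.exp ((t - τ : ℝ) * genFun w s k)‖ ^ 2) ∂(diagMeasure φ c) := by
          refine integral_mono (h1.integrable (by simp)).norm ((integrable_const 1).add h3) fun k => ?_
          dsimp only
          nlinarith [sq_nonneg (‖Complex.exp ((t - τ : ℝ) * genFun w s k)‖ - 1),
            norm_nonneg (Complex.exp ((t - τ : ℝ) * genFun w s k))]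
      _ ≤ (diagMeasure φ c).real univ + M ^ 2 := by
          rw [integral_add (integrable_const 1) h3]
          simpa using h4

/-- `∫₀ᵗ u(τ) T(t-τ) c dτ = ∫ h dE c` with `h = ∫₀ᵗ u(τ) e^{(t-τ)ζ} dτ`. -/
theorem specInt_convolution (hR : IsResolventAt A s (φ w)) (hT : IsC0Semigroup T)
    (hA : IsGenerator A T) (hc : ∀ t, 0 ≤ t → ∀ g, Commute (T t) (φ g)) (c : H)
    (hu : IntegrableOn u (Icc 0 t)) :
    MemLp (fun k => ∫ τ in Icc 0 t, Complex.exp ((t - τ : ℝ) * genFun w s k) * u τ) 2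
      (diagMeasure φ c) ∧
    specInt φ c (fun k => ∫ τ in Icc 0 t, Complex.exp ((t - τ : ℝ) * genFun w s k) * u τ) =
      ∫ τ in Icc 0 t, u τ • T (t - τ) c := by
  have hF := integrable_exp_mul_prod hR hT hA hc c hu
  have hint : IntegrableOn (fun τ => u τ • T (t - τ) c) (Icc 0 t) :=
    hu.smul_continuousOn (hT.continuousOn_sub c t) isCompact_Icc
  have hτ {τ : ℝ} (hτ : τ ∈ Icc 0 t) := semigroup_eq_specInt hR hT hA hc (sub_nonneg.2 hτ.2) c
  set y := ∫ τ in Icc 0 t, u τ • T (t - τ) c with hy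
  set V := specIntL φ c with hV
  set k0 := ContinuousLinearMap.adjoint V y with hk0
  -- The values `T(t-τ) c` all lie in the range of the isometry `V`, on which `V V*` is the
  -- identity; hence so does the integral.
  have hVk0 : V k0 = y := by
    have h1 := (V ∘L ContinuousLinearMap.adjoint V).integral_comp_comm hint
    rw [← hy] at h1
    change _ = V k0 at h1
    rw [← h1]
    refine setIntegral_congr_fun measurableSet_Icc fun τ h => ?_
    obtain ⟨h2, h3⟩ := hτ h
    change V (ContinuousLinearMap.adjoint V _) = _
    rw [h3, specInt_eq h2, map_smul, adjoint_specIntL_specIntL, map_smul]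
  have hae : k0 =ᵐ[diagMeasure φ c]
      fun k => ∫ τ in Icc 0 t, Complex.exp ((t - τ : ℝ) * genFun w s k) * u τ := by
    -- The preimage `k0` is identified through its integrals over sets `S`: these are inner products
    -- of `V 1_S` with `y`, and Fubini exchanges the two integrations.
    refine Integrable.ae_eq_of_forall_setIntegral_eq _ _ ((Lp.memLp k0).integrable (by simp))
      hF.integral_prod_left fun S hS _ => ?_
    have hb := (BddMeas.indicator hS).memLp (diagMeasure φ c)
    have hind (f : K → ℂ) : ∫ k, f k * starRingEnd ℂ (S.indicator (fun _ => 1) k)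
        ∂(diagMeasure φ c) = ∫ k in S, f k ∂(diagMeasure φ c) := by
      rw [← integral_indicator hS]
      congr 1
      ext k
      by_cases hk : k ∈ S <;> simp [hk]
    have h1 : ⟪specInt φ c (S.indicator fun _ => 1), y⟫_ℂ = ∫ k in S, k0 k ∂(diagMeasure φ c) := by
      rw [← hVk0, hV, ← specInt_coeFn, inner_specInt hb (Lp.memLp k0), hind]
    rw [← h1, hy, ← innerSL_apply_apply, ← ContinuousLinearMap.integral_comp_comm _ hint]
    have h2 : ∀ τ ∈ Icc 0 t, innerSL ℂ (specInt φ c (S.indicator fun _ => 1)) (u τ • T (t - τ) c) =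
        ∫ k in S, Complex.exp ((t - τ : ℝ) * genFun w s k) * u τ ∂(diagMeasure φ c) := by
      intro τ h
      obtain ⟨h3, h4⟩ := hτ h
      rw [innerSL_apply_apply, inner_smul_right, h4, inner_specInt hb h3, hind, integral_mul_const,
        mul_comm]
    rw [setIntegral_congr_fun measurableSet_Icc h2]
    refine (integral_integral_swap (f := fun k τ =>
      Complex.exp ((t - τ : ℝ) * genFun w s k) * u τ) ?_).symm
    refine hF.mono_measure ?_
    exact Measure.prod_mono Measure.restrict_le_self le_rfl
  refine ⟨(memLp_congr_ae hae).1 (Lp.memLp k0), ?_⟩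
  rw [← specInt_congr_ae hae, specInt_coeFn]
  exact hVk0

end Convolution

/-! ### Admissibility and the Laplace transform -/

section Equivalence

variable {K : Type*} [MetricSpace K] [CompactSpace K] [MeasurableSpace K] [BorelSpace K]
variable {H : Type*} [NormedAddCommGroup H] [InnerProductSpace ℂ H] [CompleteSpace H]
variable {φ : C(K, ℂ) →⋆ₐ[ℂ] (H →L[ℂ] H)} {w : C(K, ℂ)} {A : H →ₗ.[ℂ] H} {s : ℂ}
  {T : ℝ → H →L[ℂ] H} {c : H} {p : ℝ≥0∞}

theorem measurePreserving_sub_left_Icc (t : ℝ) :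
    MeasurePreserving (fun τ => t - τ) (volume.restrict (Icc 0 t)) (volume.restrict (Icc 0 t)) := by
  have h := (Measure.measurePreserving_sub_left volume t).restrict_preimage
    (measurableSet_Icc (a := 0) (b := t))
  rwa [preimage_const_sub_Icc, sub_self, sub_zero] at h

theorem finLaplace_neg (t : ℝ) (u : ℝ → ℂ) (z : ℂ) :
    finLaplace t u (-z) = ∫ τ in Icc 0 t, Complex.exp ((t - τ : ℝ) * z) * u (t - τ) := by
  have h := (measurePreserving_sub_left_Icc t).integral_comp
    (MeasurableEquiv.subLeft t).measurableEmbedding (fun r : ℝ => Complex.exp (r * z) * u r)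
  rw [h, finLaplace]
  congr 1
  ext r
  rw [neg_neg, mul_comm z]

/-- Both bounds come from `1/w = s - ζ`; the constant term `1` is absorbed because `|1/w| ≥ 1/‖w‖`.
-/
theorem exists_weight_bounds (w : C(K, ℂ)) (s : ℂ) : ∃ C D : NNReal, ∀ k, w k ≠ 0 →
    (1 + ‖genFun w s k‖ₑ ^ 2 ≤ (C * ‖(w k)⁻¹‖ₑ) ^ 2 ∧
      ‖(w k)⁻¹‖ₑ ^ 2 ≤ D ^ 2 * (1 + ‖genFun w s k‖ₑ ^ 2)) := by
  -- `C` combines `1 ≤ ‖w‖² |1/w|²` with `|ζ|² ≤ 2|s|² + 2|1/w|²`; `D` comes from `|1/w|² ≤ 2|s|² +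
  -- 2|ζ|²`.
  let C : NNReal := ⟨√((1 + 2 * ‖s‖ ^ 2) * ‖w‖ ^ 2 + 2), Real.sqrt_nonneg _⟩
  let D : NNReal := ⟨√(2 * ‖s‖ ^ 2 + 2), Real.sqrt_nonneg _⟩
  have hC : (C : ℝ) ^ 2 = (1 + 2 * ‖s‖ ^ 2) * ‖w‖ ^ 2 + 2 := Real.sq_sqrt (by positivity)
  have hD : (D : ℝ) ^ 2 = 2 * ‖s‖ ^ 2 + 2 := Real.sq_sqrt (by positivity)
  refine ⟨C, D, fun k hk => ?_⟩
  have h1 : 1 ≤ ‖w‖ * ‖(w k)⁻¹‖ := by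
    rw [norm_inv, ← div_eq_mul_inv, one_le_div (norm_pos_iff.2 hk)]
    exact w.norm_coe_le_norm k
  have h2 : ‖genFun w s k‖ ≤ ‖s‖ + ‖(w k)⁻¹‖ := norm_sub_le _ _
  have h3 : ‖(w k)⁻¹‖ ≤ ‖s‖ + ‖genFun w s k‖ := by
    have h4 : (w k)⁻¹ = s - genFun w s k := by simp [genFun]
    conv_lhs => rw [h4]
    exact norm_sub_le _ _
  have e1 : 1 + ‖genFun w s k‖ ^ 2 ≤ (C * ‖(w k)⁻¹‖) ^ 2 := by
    rw [mul_pow, hC]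
    have h5 : 1 ≤ (‖w‖ * ‖(w k)⁻¹‖) ^ 2 := one_le_pow₀ h1
    have h6 : ‖genFun w s k‖ ^ 2 ≤ 2 * ‖s‖ ^ 2 + 2 * ‖(w k)⁻¹‖ ^ 2 := by
      have := pow_le_pow_left₀ (norm_nonneg _) h2 2
      nlinarith [sq_nonneg (‖s‖ - ‖(w k)⁻¹‖)]
    have h7 := mul_le_mul_of_nonneg_left h5 (by positivity : (0 : ℝ) ≤ 1 + 2 * ‖s‖ ^ 2)
    linarith
  have e2 : ‖(w k)⁻¹‖ ^ 2 ≤ D ^ 2 * (1 + ‖genFun w s k‖ ^ 2) := by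
    rw [hD]
    have h6 : ‖(w k)⁻¹‖ ^ 2 ≤ 2 * ‖s‖ ^ 2 + 2 * ‖genFun w s k‖ ^ 2 := by
      have := pow_le_pow_left₀ (norm_nonneg _) h3 2
      nlinarith [sq_nonneg (‖s‖ - ‖genFun w s k‖)]
    nlinarith [mul_nonneg (sq_nonneg ‖s‖) (sq_nonneg ‖genFun w s k‖)]
  simp only [enorm_eq_nnnorm]
  exact ⟨by exact_mod_cast e1, by exact_mod_cast e2⟩

theorem eLpNorm_carlesonMeasure_sq {E : ProjectionMeasure H}
    (hE : E.diag c = (diagMeasure φ c).map (genFun w s)) {f : ℂ → ℂ} (hf : Measurable f) :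
    eLpNorm f 2 (carlesonMeasure E c) ^ 2 =
      ∫⁻ k, (1 + ‖genFun w s k‖ₑ ^ 2) * ‖f (-genFun w s k)‖ₑ ^ 2 ∂(diagMeasure φ c) := by
  have h1 : Measurable fun z : ℂ => 1 + ‖z‖ₑ ^ 2 := by fun_prop
  have h2 : Measurable fun z : ℂ => ‖f z‖ₑ ^ 2 := hf.enorm.pow_const 2
  have h3 : Measurable fun z : ℂ => ‖f (-z)‖ₑ ^ 2 := h2.comp measurable_neg
  rw [eLpNorm_two_sq, carlesonMeasure, lintegral_map h2 measurable_neg, hE,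
    lintegral_withDensity_eq_lintegral_mul _ h1 h3, lintegral_map (h1.mul h3) measurable_genFun]
  rfl

theorem exists_eLpNorm_carlesonMeasure_bounds (hw : Function.Injective (φ w))
    {E : ProjectionMeasure H} (hE : E.diag c = (diagMeasure φ c).map (genFun w s)) :
    ∃ C D : NNReal, ∀ f : ℂ → ℂ, Measurable f →
      (eLpNorm f 2 (carlesonMeasure E c) ≤
        C * eLpNorm ((fun k => f (-genFun w s k)) / ⇑w) 2 (diagMeasure φ c) ∧
      eLpNorm ((fun k => f (-genFun w s k)) / ⇑w) 2 (diagMeasure φ c) ≤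
        D * eLpNorm f 2 (carlesonMeasure E c)) := by
  obtain ⟨C, D, hCD⟩ := exists_weight_bounds w s
  refine ⟨C, D, fun f hf => ?_⟩
  have hmeas : Measurable fun k => f (-genFun w s k) := hf.comp measurable_genFun.neg
  constructor
  · rw [← ENNReal.pow_le_pow_left_iff two_ne_zero, mul_pow, eLpNorm_carlesonMeasure_sq hE hf,
      eLpNorm_two_sq, ← lintegral_const_mul' _ _ (by simp)]
    refine lintegral_mono_ae ?_
    filter_upwards [ae_ne_zero_of_injective hw c] with k hk
    refine (mul_le_mul_left (hCD k hk).1 _).trans_eq ?_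
    rw [Pi.div_apply, div_eq_mul_inv, enorm_mul]
    ring
  · rw [← ENNReal.pow_le_pow_left_iff two_ne_zero, mul_pow, eLpNorm_carlesonMeasure_sq hE hf,
      eLpNorm_two_sq, ← lintegral_const_mul' _ _ (by simp)]
    refine lintegral_mono_ae ?_
    filter_upwards [ae_ne_zero_of_injective hw c] with k hk
    rw [Pi.div_apply, div_eq_mul_inv, enorm_mul, mul_pow, mul_comm, ← mul_assoc]
    exact mul_le_mul_left (hCD k hk).2 _

/-- The convolution is the spectral integral of `f(-ζ)` with `f` a finite Laplace transform. Solving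
`φ w x = ∫ f(-ζ) dE c` means dividing by `w`, and this division is the weight of the Carleson
measure. -/
theorem admissible_iff_finLaplaceBounded [hp : Fact (1 ≤ p)] (hR : IsResolventAt A s (φ w))
    (hT : IsC0Semigroup T) (hA : IsGenerator A T)
    (hc : ∀ t, 0 ≤ t → ∀ g, Commute (T t) (φ g)) {E : ProjectionMeasure H}
    (hE : E.diag c = (diagMeasure φ c).map (genFun w s)) :
    (∃ C : ℝ, ∀ t : ℝ, 0 ≤ t → ∀ u : ℝ → ℂ, MemLp u p (volume.restrict (Icc 0 t)) →
      ∃ x : H, φ w x = ∫ τ in Icc 0 t, u τ • T (t - τ) c ∧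
        ‖x‖ ≤ C * (eLpNorm u p (volume.restrict (Icc 0 t))).toReal) ↔
    FinLaplaceBounded p (carlesonMeasure E c) := by
  obtain ⟨D₁, D₂, hD⟩ := exists_eLpNorm_carlesonMeasure_bounds hR.injective hE
  have hmp := measurePreserving_sub_left_Icc
  have hconv {t : ℝ} {u : ℝ → ℂ} (hu : MemLp u p (volume.restrict (Icc 0 t))) :
      MemLp (fun k => finLaplace t u (-genFun w s k)) 2 (diagMeasure φ c) ∧
      specInt φ c (fun k => finLaplace t u (-genFun w s k)) =
        ∫ τ in Icc 0 t, u (t - τ) • T (t - τ) c := by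
    simp_rw [finLaplace_neg]
    exact specInt_convolution hR hT hA hc c
      (integrableOn_of_memLp (hu.comp_measurePreserving (hmp t)))
  constructor
  · rintro ⟨C, hC⟩
    refine ⟨D₁ * max C 0, fun t ht u hu => ?_⟩
    -- The convolution reverses time, so the hypothesis is applied to `τ ↦ u(t - τ)`, which has the
    -- same `Lᵖ` norm.
    have hu' := hu.comp_measurePreserving (hmp t)
    obtain ⟨x, hx, hxC⟩ := hC t ht _ hu'
    obtain ⟨h1, h2⟩ := hconv hu
    obtain ⟨h3, h4⟩ := memLp_div_of_apply_eq hR.injective h1 (hx.trans h2.symm)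
    refine (hD _ (stronglyMeasurable_finLaplace hu.1).measurable).1.trans ?_
    rw [← enorm_specInt h3, ← h4, ENNReal.ofReal_mul D₁.coe_nonneg, ENNReal.ofReal_coe_nnreal,
      mul_assoc]
    refine mul_le_mul_right ?_ _
    rw [← ofReal_norm, ← ENNReal.ofReal_toReal hu.eLpNorm_ne_top,
      ← ENNReal.ofReal_mul (le_max_right _ _)]
    refine ENNReal.ofReal_le_ofReal (hxC.trans ?_)
    rw [eLpNorm_comp_measurePreserving hu.1 (hmp t)]
    gcongr
    exact le_max_left _ _
  · rintro ⟨C, hC⟩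
    refine ⟨D₂ * max C 0, fun t ht u hu => ?_⟩
    have hu' := hu.comp_measurePreserving (hmp t)
    obtain ⟨h1, h2⟩ := hconv hu'
    have hm := (stronglyMeasurable_finLaplace hu'.1).measurable
    have h3 := (hD _ hm).2.trans (mul_le_mul_right (hC t ht _ hu') _)
    rw [eLpNorm_comp_measurePreserving hu.1 (hmp t)] at h3
    have h4 : MemLp ((fun k => finLaplace t (u ∘ fun τ => t - τ) (-genFun w s k)) / ⇑w) 2
        (diagMeasure φ c) := by
      refine ⟨((hm.comp measurable_genFun.neg).div w.continuous.measurable).aestronglyMeasurable,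
        h3.trans_lt ?_⟩
      exact ENNReal.mul_lt_top ENNReal.coe_lt_top
        (ENNReal.mul_lt_top ENNReal.ofReal_lt_top hu.eLpNorm_lt_top)
    refine ⟨specInt φ c _, (apply_specInt_div hR.injective h4).trans (h2.trans ?_), ?_⟩
    · simp
    · rw [← enorm_specInt h4] at h3
      have h5 := ENNReal.toReal_mono (ENNReal.mul_ne_top ENNReal.coe_ne_top
        (ENNReal.mul_ne_top ENNReal.ofReal_ne_top hu.eLpNorm_ne_top)) h3
      rw [toReal_enorm, ENNReal.toReal_mul, ENNReal.toReal_mul, ENNReal.coe_toReal, ← mul_assoc,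
        ENNReal.toReal_ofReal'] at h5
      exact h5

end Equivalence

/-! ### Passage from the extrapolation space to the spectrum of the resolvent -/

section Main

variable {X : Type*} [NormedAddCommGroup X] [InnerProductSpace ℂ X] [CompleteSpace X]
variable {A : X →ₗ.[ℂ] X} {s : ℂ} {R : X →L[ℂ] X} {T : ℝ → X →L[ℂ] X} {c : X}

/-- The identity function on the spectrum. -/
def spectrumId (R : X →L[ℂ] X) : C(spectrum ℂ R, ℂ) := (ContinuousMap.id ℂ).restrict (spectrum ℂ R)

theorem isResolventAt_cfcHom (hR : IsResolventAt A s R) (hRn : IsStarNormal R) :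
    IsResolventAt A s (cfcHom (R := ℂ) hRn (spectrumId R)) := by
  rw [spectrumId, cfcHom_id]
  exact hR

/-- Almost every point of the measure is `-ζ(k) = 1/k - s` with `0 ≠ k ∈ σ(R)`, and such a point
cannot be in the resolvent set of `-A`. -/
theorem carlesonMeasure_restrict (hR : IsResolventAt A s R) (hRn : IsStarNormal R)
    {E : ProjectionMeasure X}
    (hE : E.diag c = (diagMeasure (cfcHom (R := ℂ) hRn) c).map (genFun (spectrumId R) s)) :
    (carlesonMeasure E c).restrict (opSpectrum (-A)) = carlesonMeasure E c := by
  refine Measure.restrict_eq_self_of_ae_mem ?_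
  -- A visibly Borel set contained in the spectrum of `-A`; it carries the measure, and
  -- measurability of the spectrum itself is not required.
  set N : Set ℂ := {z | s + z ≠ 0 ∧ (s + z)⁻¹ ∈ spectrum ℂ R} with hN
  have hNm : MeasurableSet N := by
    refine MeasurableSet.inter ?_ ?_
    · exact (measurableSet_eq_fun (by fun_prop) measurable_const).compl
    · exact (measurable_const.add measurable_id).inv (spectrum.isClosed (𝕜 := ℂ) R).measurableSet
  have h1 : ∀ᵐ z ∂(carlesonMeasure E c), z ∈ N := by
    have hneg : Measurable fun z : ℂ => -z := measurable_neg
    rw [carlesonMeasure]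
    refine (ae_map_iff hneg.aemeasurable hNm).2 ?_
    refine (withDensity_absolutelyContinuous _ _).ae_le ?_
    rw [hE]
    refine (ae_map_iff measurable_genFun.aemeasurable (hneg hNm)).2 ?_
    filter_upwards [ae_ne_zero_of_injective (isResolventAt_cfcHom hR hRn).injective c] with k hk
    have h2 : s + -genFun (spectrumId R) s k = (k : ℂ)⁻¹ := by
      simp only [genFun, spectrumId, ContinuousMap.restrict_apply, ContinuousMap.id_apply]
      ring
    refine ⟨?_, ?_⟩
    · rw [h2]
      exact inv_ne_zero hk
    · rw [h2, inv_inv]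
      exact k.2
  filter_upwards [h1] with z hz hzr
  refine inv_sub_notMem_spectrum hR (neg_mem_opResolventSet hzr) (inv_ne_zero hz.1) ?_ hz.2
  rw [inv_inv]
  ring

/-- Apply `J`, which is injective, commutes with the integral and the semigroup, and sends the
embedded `x` to its resolvent. -/
theorem infiniteTimeAdmissible_iff {p : ℝ≥0∞} (hd : DenseRange (opResolvent A s))
    (hc : ∀ t, 0 ≤ t → Commute (T t) (opResolvent A s)) (b : Extrapolation A s) :
    InfiniteTimeAdmissible p A s T (ContinuousLinearMap.toSpanSingleton ℂ b) ↔
    ∃ C : ℝ, ∀ t : ℝ, 0 ≤ t → ∀ u : ℝ → ℂ, MemLp u p (volume.restrict (Icc 0 t)) →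
      ∃ x : X, opResolvent A s x =
          ∫ τ in Icc 0 t, u τ • T (t - τ) (extrapolationEquiv hd b) ∧
        ‖x‖ ≤ C * (eLpNorm u p (volume.restrict (Icc 0 t))).toReal := by
  set J := extrapolationEquiv hd with hJ
  have key (t : ℝ) (u : ℝ → ℂ) (x : X) :
      embed A s x = ∫ τ in Icc 0 t, extendedSemigroup A s T (t - τ)
        (ContinuousLinearMap.toSpanSingleton ℂ b (u τ)) ↔
      opResolvent A s x = ∫ τ in Icc 0 t, u τ • T (t - τ) (J b) := by
    rw [← J.injective.eq_iff, hJ, extrapolationEquiv_embed, ← hJ]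
    have h1 := J.toContinuousLinearEquiv.integral_comp_comm (μ := volume.restrict (Icc 0 t))
      fun τ => extendedSemigroup A s T (t - τ) (ContinuousLinearMap.toSpanSingleton ℂ b (u τ))
    have h2 : ∀ τ ∈ Icc 0 t, J (extendedSemigroup A s T (t - τ)
        (ContinuousLinearMap.toSpanSingleton ℂ b (u τ))) = u τ • T (t - τ) (J b) := by
      intro τ hτ
      rw [hJ, extrapolationEquiv_extendedSemigroup hd (hc _ (sub_nonneg.2 hτ.2)),
        ContinuousLinearMap.toSpanSingleton_apply, map_smul, map_smul]
    rw [← setIntegral_congr_fun measurableSet_Icc h2]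
    exact ⟨fun h => h.trans h1.symm, fun h => h.trans h1⟩
  simp only [InfiniteTimeAdmissible, key]

/-- The scalar spectral measures of the generator of a normal semigroup. -/
theorem isSpectralMeasureOf_extendedGenerator (hs : s ∈ opResolventSet A)
    (hRn : IsStarNormal (opResolvent A s)) (hd : DenseRange (opResolvent A s)) :
    IsSpectralMeasureOf (spectralMeasure (extendedGenerator A s)) (extendedGenerator A s) ∧
      ∀ b, (spectralMeasure (extendedGenerator A s)).diag b =
        (diagMeasure (cfcHom (R := ℂ) hRn) (extrapolationEquiv hd b)).map
          (genFun (spectrumId (opResolvent A s)) s) := by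
  set J := extrapolationEquiv hd
  have hR := isResolventAt_opResolvent hs
  have hE := isSpectralMeasureOf_projMeasure (isResolventAt_cfcHom hR hRn)
  have hgraph := mem_graph_extendedGenerator hs hd
  have hex : ∃ F, IsSpectralMeasureOf F (extendedGenerator A s) := ⟨_, hE.conj J hgraph⟩
  have hF : IsSpectralMeasureOf (spectralMeasure (extendedGenerator A s))
      (extendedGenerator A s) := by
    rw [spectralMeasure, dif_pos hex]
    exact hex.choose_spec
  refine ⟨hF, fun b => ?_⟩
  have hF' := hF.conj J.symm (B := A) fun x y => by
    rw [hgraph, J.apply_symm_apply, J.apply_symm_apply]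
  -- The chosen measure, carried over to `X`, is compared with the constructed one. Its projections
  -- commute with `R` and, being self-adjoint, with `R*`, hence with the whole Borel calculus of
  -- `R`.
  have h1 := hE.diag_eq hF' (fun S S' hS hS' => ?_) (J b)
  · rw [diag_projMeasure, ProjectionMeasure.diag_conj, J.symm_apply_apply] at h1
    exact h1.symm
  · set F := (spectralMeasure (extendedGenerator A s)).conj J.symm
    have h2 : Commute (F.proj S') (opResolvent A s) := hF'.commute_resolvent hR hS'
    have h3 : Commute (F.proj S') (star (opResolvent A s)) := by
      have := h2.star_star
      rwa [(F.isStarProjection S' hS').isSelfAdjoint.star_eq] at this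
    have h4 (g : C(spectrum ℂ (opResolvent A s), ℂ)) : Commute (F.proj S') (cfcHom hRn g) :=
      (Commute.cfcHom hRn h2.symm h3.symm g).symm
    refine ContinuousLinearMap.ext fun x => ?_
    rw [mul_apply_eq_comp, mul_apply_eq_comp, projMeasure_apply measurable_genFun hS,
      projMeasure_apply measurable_genFun hS]
    exact (specInt_commute (BddMeas.indicator (measurable_genFun hS)) _ h4 x).symm

end Main

end LaplaceCarleson

end

open LaplaceCarleson
theorem mainTheorem2 {X : Type*} [NormedAddCommGroup X] [InnerProductSpace ℂ X] [CompleteSpace X]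
    (T : ℝ → X →L[ℂ] X) (hT : IsC0Semigroup T) (hTn : ∀ t : ℝ, 0 ≤ t → IsStarNormal (T t))
    (A : X →ₗ.[ℂ] X) (hA : IsGenerator A T)
    (s : ℂ) (hs : s ∈ opResolventSet A) :
    IsSpectralMeasureOf (spectralMeasure (extendedGenerator A s)) (extendedGenerator A s) ∧
      ∀ (p : ENNReal) [Fact (1 ≤ p)] (b : Extrapolation A s),
        InfiniteTimeAdmissible p A s T (ContinuousLinearMap.toSpanSingleton ℂ b) ↔
          LaplaceBounded p
            ((carlesonMeasure (spectralMeasure (extendedGenerator A s)) b).restrict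
              (opSpectrum (-A))) := by
  have hR := isResolventAt_opResolvent hs
  have hRn := isStarNormal_resolvent hT hTn hA hR
  have hd := denseRange_of_isStarNormal hRn hR.injective
  obtain ⟨h1, h2⟩ := isSpectralMeasureOf_extendedGenerator hs hRn hd
  refine ⟨h1, fun p hp b => ?_⟩
  set c := extrapolationEquiv hd b with hc
  have hcomm (t : ℝ) (ht : 0 ≤ t) : Commute (T t) (opResolvent A s) :=
    commute_semigroup_resolvent hT hA hR ht
  have hcomm' (t : ℝ) (ht : 0 ≤ t) (g : C(spectrum ℂ (opResolvent A s), ℂ)) :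
      Commute (T t) (cfcHom hRn g) :=
    (Commute.cfcHom hRn (hcomm t ht).symm (commute_star_resolvent_semigroup hT hTn hA hR ht) g).symm
  set E := projMeasure (cfcHom (R := ℂ) hRn) (genFun (spectrumId (opResolvent A s)) s)
    measurable_genFun
  have hE := diag_projMeasure (φ := cfcHom (R := ℂ) hRn)
    (measurable_genFun (w := spectrumId (opResolvent A s)) (s := s)) c
  -- The scalar measure of `b` in `X₋₁` is that of `c = J b` in `X`, since `J` is unitary.
  have hν : carlesonMeasure (spectralMeasure (extendedGenerator A s)) b = carlesonMeasure E c := by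
    rw [carlesonMeasure, carlesonMeasure, h2 b, hE]
  have h3 := admissible_iff_finLaplaceBounded (p := p) (isResolventAt_cfcHom hR hRn) hT hA hcomm' hE
  rw [hν, carlesonMeasure_restrict hR hRn hE, infiniteTimeAdmissible_iff hd hcomm]
  rw [spectrumId, cfcHom_id] at h3
  exact h3.trans ⟨FinLaplaceBounded.laplaceBounded, LaplaceBounded.finLaplaceBounded⟩
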